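/- Let $f_0\in H^0(\mathcal O_{\mathbf P^n}(h))$ define a smooth hypersurface in complex projective space $\mathbf P^n$, and let $L_0,\dots,L_h\in H^0(\mathcal O_{\mathbf P^n}(1))$ be nonzero linear forms with $\mathrm{div}(L_i)\neq \mathrm{div}(L_j)$ for $i\ne j$. Put $$F(a,x)=f_0(x)+\sum_{i=0}^h a_i\,M_i(x),\qquad M_i=L_0\cdots\widehat{L_i}\cdots L_h ,$$ let $A\subset\mathbf C^{h+1}$ be the set of all $a$ for which the hypersurface $\{F(a,\cdot)=0\}\subset\mathbf P^n$ is smooth, let $W=\mathbf P^n\setminus\bigcup_{i<j}\{L_i=L_j=0\}$, and let $X_W=\{(a,x)\in A\times W: F(a,x)=0\}$. Write $(1)$ for the twist by the pull-back of $\mathcal O_{\mathbf P^n}(1)$, and let $T_{W/A}=\{0\}\oplus TW\subset T(A\times W)$ and $T_{A/W}=TA\oplus\{0\}\subset T(A\times W)$. Then the twisted vector fields $u_i=L_0\,\partial/\partial a_0-L_i\,\partial/\partial a_i$, $i=1,\dots,h$, are regular sections of $TX_W(1)$ and span a subbundle $G(1)\subset TX_W(1)$ of rank $h$. The restriction $T_{W/A}(1)|_{X_W}$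 is an algebraic vector bundle of rank $n$, and there is an isomorphism of algebraic vector bundles on $X_W$ $$I:\ TX_W(1)/G(1)\ \xrightarrow{\ \sim\ }\ T_{W/A}(1)|_{X_W},$$ which maps the class of $\tau=\alpha+v$, with $\alpha\in T_{A/W}(1)$ and $v\in T_{W/A}(1)$, to $-v$. Moreover, at every point $(0,x)$ of $X_W$ (that is, over $\{f_0\}\times(\{f_0=0\}\cap W)$), $I$ is compatible with the differential maps to $\mathcal O(h+1)$: for every $\tau\in TX_W(1)$ at this point, $$\nu(I([\tau]))=\mu(\tau),$$ where $\mu:TX_W(1)\to\mathcal O_{\mathbf P^n}(h+1)$ sends a vector with $A$-component $\sum_i\alpha_i\,\partial/\partial a_i$ to $\partial F/\partial\alpha=\sum_i\alpha_i M_i$, and $\nu(\beta)=\partial f_0/\partial\beta$ for $\beta\in TW(1)$. -/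

import Mathlib

open MvPolynomial Topology Filter
open scoped TensorProduct LinearAlgebra.Projectivization

noncomputable section

namespace ClemensFamily

/-! ### Subvarieties of `ℂ^m × ℙ^n` and their regular functions -/

/-- The points of `ℂ^m × ℙ^n`. -/
@[ext]
structure AffProj (m n : ℕ) where
  a : Fin m → ℂ
  x : ℙ ℂ (Fin (n + 1) → ℂ)

/-- Polynomials in the affine coordinates `a` and the homogeneous coordinates `x`; homogeneity
(`MvPolynomial.IsHomogeneous`) refers to `x` only. -/
abbrev BiPoly (m n : ℕ) := MvPolynomial (Fin (n + 1)) (MvPolynomial (Fin m) ℂ)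

/-- The value `P(a, w)`. -/
def ev {m n : ℕ} (P : BiPoly m n) (a : Fin m → ℂ) (w : Fin (n + 1) → ℂ) : ℂ :=
  eval w (map (eval a) P)

/-- The value at a representative of a point; the ratio of two polynomials of the same degree
in `x`, and the vanishing of one, do not depend on the representative. -/
def evp {m n : ℕ} (P : BiPoly m n) (q : AffProj m n) : ℂ := ev P q.a q.x.rep

/-- The Zariski topology. -/
instance zariskiTopology (m n : ℕ) : TopologicalSpace (AffProj m n) :=
  TopologicalSpace.generateFrom
    {U | ∃ (d : ℕ) (P : BiPoly m n), P.IsHomogeneous d ∧ U = {q | evp P q ≠ 0}}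

variable {m n : ℕ}

/-- `f` is regular at `p`: near `p` it is a ratio of polynomials, homogeneous in `x` of the same
degree. -/
def IsRegularAt (S : Set (AffProj m n)) (p : S) (f : S → ℂ) : Prop :=
  ∃ (d : ℕ) (P Q : BiPoly m n), P.IsHomogeneous d ∧ Q.IsHomogeneous d ∧ evp Q p.1 ≠ 0 ∧
    ∀ᶠ q : S in 𝓝 p, f q = evp P q.1 / evp Q q.1

lemma evp_add (P Q : BiPoly m n) (q : AffProj m n) : evp (P + Q) q = evp P q + evp Q q := by
  simp [evp, ev]

lemma evp_mul (P Q : BiPoly m n) (q : AffProj m n) : evp (P * Q) q = evp P q * evp Q q := by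
  simp [evp, ev]

lemma eventually_evp_ne {S : Set (AffProj m n)} (p : S) {d : ℕ} {Q : BiPoly m n}
    (hQ : Q.IsHomogeneous d) (h : evp Q p.1 ≠ 0) : ∀ᶠ q : S in 𝓝 p, evp Q q.1 ≠ 0 := by
  have ho : IsOpen {q : AffProj m n | evp Q q ≠ 0} :=
    TopologicalSpace.isOpen_generateFrom_of_mem ⟨d, Q, hQ, rfl⟩
  exact (ho.preimage continuous_subtype_val).mem_nhds h

/-- The functions on `S` that are regular at `p`. The local ring of `S` at `p` is the ring of
germs at `p` of its elements. -/
def regAt (S : Set (AffProj m n)) (p : S) : Subalgebra ℂ (S → ℂ) where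
  carrier := {f | IsRegularAt S p f}
  mul_mem' := by
    rintro f g ⟨d, P, Q, hP, hQ, h0, hf⟩ ⟨d', P', Q', hP', hQ', h0', hg⟩
    refine ⟨d + d', P * P', Q * Q', hP.mul hP', hQ.mul hQ', ?_, ?_⟩
    · rw [evp_mul]; exact mul_ne_zero h0 h0'
    · filter_upwards [hf, hg] with q h1 h2
      simp only [Pi.mul_apply, h1, h2, evp_mul]
      rw [div_mul_div_comm]
  add_mem' := by
    rintro f g ⟨d, P, Q, hP, hQ, h0, hf⟩ ⟨d', P', Q', hP', hQ', h0', hg⟩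
    refine ⟨d + d', P * Q' + Q * P', Q * Q', (hP.mul hQ').add (hQ.mul hP'), hQ.mul hQ', ?_, ?_⟩
    · rw [evp_mul]; exact mul_ne_zero h0 h0'
    · filter_upwards [hf, hg, eventually_evp_ne p hQ h0, eventually_evp_ne p hQ' h0']
        with q h1 h2 h3 h4
      simp only [Pi.add_apply, h1, h2, evp_mul, evp_add]
      rw [div_add_div _ _ h3 h4]
  algebraMap_mem' := by
    intro r
    refine ⟨0, C (C r), 1, isHomogeneous_C _ _, isHomogeneous_one _ _, ?_, ?_⟩
    · simp [evp, ev]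
    · exact Eventually.of_forall fun q => by simp [evp, ev]

/-- The restriction to `S ⊆ Z` of a function on `Z`, regular at a point of `S`. -/
def restrictFun {S Z : Set (AffProj m n)} (h : S ⊆ Z) (p : S) :
    regAt Z (Set.inclusion h p) →ₗ[ℂ] regAt S p where
  toFun f := ⟨fun q => f.1 (Set.inclusion h q), by
    obtain ⟨d, P, Q, hP, hQ, h0, hf⟩ := f.2
    exact ⟨d, P, Q, hP, hQ, h0, (continuous_inclusion h).continuousAt.eventually hf⟩⟩
  map_add' _ _ := rfl
  map_smul' _ _ := rfl

/-- The affine coordinate function `a_i`. -/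
def coordA (S : Set (AffProj m n)) (p : S) (i : Fin m) : regAt S p :=
  ⟨fun q => q.1.a i, 0, C (X i), 1, isHomogeneous_C _ _, isHomogeneous_one _ _, by simp [evp, ev],
    Eventually.of_forall fun q => by simp [evp, ev]⟩

/-! ### Tangent vectors -/

/-- The Zariski tangent space of `S` at `p`: the point derivations at `p`. A derivation of
`regAt S p` automatically kills the functions that vanish near `p` (such an `f` is `f * g` with
`g` the indicator function of `f ≠ 0`), so these are the derivations of the local ring. -/
def tangentSpace (S : Set (AffProj m n)) (p : S) : Submodule ℂ (Module.Dual ℂ (regAt S p)) where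
  carrier := {D | ∀ f g, D (f * g) = f.1 p * D g + g.1 p * D f}
  add_mem' := by
    intro D E hD hE f g
    simp only [LinearMap.add_apply, hD f g, hE f g]
    ring
  zero_mem' := by intro f g; simp
  smul_mem' := by
    intro c D hD f g
    simp only [LinearMap.smul_apply, hD f g, smul_eq_mul]
    ring

/-- The differential `T_p S → T_p Z` of an inclusion `S ⊆ Z`. -/
def dIncl {S Z : Set (AffProj m n)} (h : S ⊆ Z) (p : S) :
    tangentSpace S p →ₗ[ℂ] tangentSpace Z (Set.inclusion h p) where
  toFun D := ⟨D.1 ∘ₗ restrictFun h p, fun f g => D.2 (restrictFun h p f) (restrictFun h p g)⟩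
  map_add' _ _ := rfl
  map_smul' _ _ := rfl

/-- The tangent vectors at `p` along the fibre through `p` of a map `pr`: those that kill all
functions factoring through `pr`. -/
def relTangentSpace {B : Type} (pr : AffProj m n → B) (S : Set (AffProj m n)) (p : S) :
    Submodule ℂ (tangentSpace S p) where
  carrier := {D | ∀ f : regAt S p, (∃ g : B → ℂ, ∀ q, f.1 q = g (pr q.1)) → D.1 f = 0}
  add_mem' := by
    intro D E hD hE f hf
    simp [hD f hf, hE f hf]
  zero_mem' := by intro f _; rfl
  smul_mem' := by
    intro c D hD f hf
    simp [hD f hf]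

/-- The affine line through `p` in the direction of the coordinate `a_i`. -/
def lineA (p : AffProj m n) (i : Fin m) (t : ℂ) : AffProj m n := ⟨p.a + Pi.single i t, p.x⟩

lemma differentiable_evp_lineA (P : BiPoly m n) (p : AffProj m n) (i : Fin m) :
    Differentiable ℂ fun t => evp P (lineA p i t) := by
  have key : ∀ R : MvPolynomial (Fin m) ℂ,
      Differentiable ℂ fun t : ℂ => eval (p.a + Pi.single i t) R := by
    intro R
    induction R using MvPolynomial.induction_on with
    | C r => simp
    | add R R' h h' => simpa using h.fun_add h'
    | mul_X R j h =>
      simp only [map_mul, eval_X, Pi.add_apply]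
      refine h.mul ((differentiable_const _).add ?_)
      by_cases hj : j = i
      · subst hj; simp
      · simp [Pi.single_eq_of_ne hj]
  induction P using MvPolynomial.induction_on with
  | C R => simpa [evp, ev, lineA] using key R
  | add P P' h h' => simpa [evp_add] using h.fun_add h'
  | mul_X P j h =>
    simp only [evp_mul]
    refine h.mul ?_
    simp [evp, ev, lineA]

lemma continuous_lineA (p : AffProj m n) (i : Fin m) : Continuous (lineA p i) := by
  refine continuous_generateFrom_iff.2 ?_
  rintro _ ⟨d, P, _, rfl⟩
  exact isOpen_ne.preimage (differentiable_evp_lineA P p i).continuous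

lemma lineA_zero (p : AffProj m n) (i : Fin m) : lineA p i 0 = p := by
  simp [lineA]

lemma differentiableAt_lineA (p : (Set.univ : Set (AffProj m n))) (i : Fin m)
    (f : regAt Set.univ p) :
    DifferentiableAt ℂ (fun t => f.1 ⟨lineA p.1 i t, trivial⟩) 0 := by
  obtain ⟨d, P, Q, -, -, h0, hf⟩ := f.2
  have hc : Tendsto (fun t => (⟨lineA p.1 i t, trivial⟩ : (Set.univ : Set (AffProj m n))))
      (𝓝 0) (𝓝 p) := by
    have h1 := ((continuous_lineA p.1 i).subtype_mk (fun _ => Set.mem_univ _)).tendsto 0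
    have h2 : (⟨lineA p.1 i 0, trivial⟩ : (Set.univ : Set (AffProj m n))) = p :=
      Subtype.ext (lineA_zero p.1 i)
    rwa [h2] at h1
  have hd : DifferentiableAt ℂ (fun t => evp P (lineA p.1 i t) / evp Q (lineA p.1 i t)) 0 := by
    refine (differentiable_evp_lineA P p.1 i 0).div (differentiable_evp_lineA Q p.1 i 0) ?_
    rwa [lineA_zero]
  exact hd.congr_of_eventuallyEq (hc.eventually hf)

/-- The tangent vector `∂/∂a_i` of `ℂ^m × ℙ^n` at `p`. -/
def partialA (p : (Set.univ : Set (AffProj m n))) (i : Fin m) : tangentSpace Set.univ p :=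
  ⟨{ toFun := fun f => deriv (fun t => f.1 ⟨lineA p.1 i t, trivial⟩) 0
     map_add' := fun f g =>
       deriv_fun_add (differentiableAt_lineA p i f) (differentiableAt_lineA p i g)
     map_smul' := fun c f => deriv_const_mul c (differentiableAt_lineA p i f) }, by
    intro f g
    have h := deriv_fun_mul (differentiableAt_lineA p i f) (differentiableAt_lineA p i g)
    have hp : (⟨lineA p.1 i 0, trivial⟩ : (Set.univ : Set (AffProj m n))) = p :=
      Subtype.ext (lineA_zero p.1 i)
    rw [hp] at h
    refine h.trans ?_
    simp only [LinearMap.coe_mk, AddHom.coe_mk]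
    ring⟩

/-! ### Bundles

A bundle (`RegBundle`) is given by its fibres together with its regular local sections. -/

/-- A family of vector spaces over `S`, with a notion of a section being regular at a point. -/
structure RegBundle (S : Set (AffProj m n)) where
  fibre : S → Type
  [addCommGroup : ∀ p, AddCommGroup (fibre p)]
  [module : ∀ p, Module ℂ (fibre p)]
  IsRegAt : S → (∀ q, fibre q) → Prop

attribute [instance] RegBundle.addCommGroup RegBundle.module

namespace RegBundle

variable {S : Set (AffProj m n)}

/-- `E` is a vector bundle of rank `r`: near every point there is a frame in which the regular
sections are those with regular coefficients. -/
def IsLocallyFree (E : RegBundle S) (r : ℕ) : Prop :=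
  ∀ p : S, ∃ e : Fin r → ∀ q, E.fibre q, ∀ᶠ q in 𝓝 p,
    (∃ b : Module.Basis (Fin r) ℂ (E.fibre q), ∀ i, b i = e i q) ∧
    ∀ s : ∀ q, E.fibre q, E.IsRegAt q s ↔
      ∃ g : Fin r → S → ℂ, (∀ i, IsRegularAt S q (g i)) ∧
        ∀ᶠ q' in 𝓝 q, s q' = ∑ i, g i q' • e i q'

/-- Isomorphisms of bundles: fibrewise linear isomorphisms under which the regular local sections
correspond to each other. -/
structure Iso (E F : RegBundle S) where
  equiv : ∀ p, E.fibre p ≃ₗ[ℂ] F.fibre p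
  isRegAt_iff : ∀ (p : S) (s : ∀ q, E.fibre q),
    E.IsRegAt p s ↔ F.IsRegAt p (fun q => equiv q (s q))

/-- The tensor product; its regular sections are locally the finite sums of `s ⊗ t`. -/
def tensor (E F : RegBundle S) : RegBundle S where
  fibre p := E.fibre p ⊗[ℂ] F.fibre p
  IsRegAt p r := ∃ (k : ℕ) (s : Fin k → ∀ q, E.fibre q) (t : Fin k → ∀ q, F.fibre q),
    (∀ i, E.IsRegAt p (s i)) ∧ (∀ i, F.IsRegAt p (t i)) ∧
      ∀ᶠ q in 𝓝 p, r q = ∑ i, s i q ⊗ₜ[ℂ] t i q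

/-- A subbundle; its regular sections are those that are regular in the ambient bundle. -/
def sub (E : RegBundle S) (G : ∀ p, Submodule ℂ (E.fibre p)) : RegBundle S where
  fibre p := G p
  IsRegAt p s := E.IsRegAt p (fun q => (s q : E.fibre q))

/-- The quotient by a subbundle; its regular sections are locally the classes of regular
sections. -/
def quot (E : RegBundle S) (G : ∀ p, Submodule ℂ (E.fibre p)) : RegBundle S where
  fibre p := E.fibre p ⧸ G p
  IsRegAt p s := ∃ t : ∀ q, E.fibre q, E.IsRegAt p t ∧
    ∀ᶠ q in 𝓝 p, s q = Submodule.Quotient.mk (t q)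

/-- The restriction to `S ⊆ Z` of a bundle on `Z`; its regular sections are locally the
combinations of restricted regular sections with regular functions on `S` as coefficients. -/
def restrict {Z : Set (AffProj m n)} (E : RegBundle Z) (h : S ⊆ Z) : RegBundle S where
  fibre p := E.fibre (Set.inclusion h p)
  IsRegAt p r := ∃ (k : ℕ) (g : Fin k → S → ℂ) (s : Fin k → ∀ q, E.fibre q),
    (∀ i, IsRegularAt S p (g i)) ∧ (∀ i, E.IsRegAt (Set.inclusion h p) (s i)) ∧
      ∀ᶠ q in 𝓝 p, r q = ∑ i, g i q • s i (Set.inclusion h q)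

end RegBundle

open Classical in
/-- The function `q ↦ s_q(f)` (with value `0` where `f` is not regular). -/
def applyField (S : Set (AffProj m n)) (s : ∀ q, tangentSpace S q) (f : S → ℂ) : S → ℂ :=
  fun q => if h : f ∈ regAt S q then (s q).1 ⟨f, h⟩ else 0

/-- The tangent bundle; a vector field is regular if it maps regular functions to regular
functions. -/
def tangentBundle (S : Set (AffProj m n)) : RegBundle S where
  fibre p := tangentSpace S p
  IsRegAt p s := ∀ f ∈ regAt S p, IsRegularAt S p (applyField S s f)

/-- The fibre of `O(k)` at a point of `ℙ^n`: the functions on the corresponding line that are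
homogeneous of degree `k`. -/
def lineFun (k : ℕ) (x : ℙ ℂ (Fin (n + 1) → ℂ)) : Submodule ℂ (x.submodule → ℂ) where
  carrier := {s | ∀ (c : ℂ) (w : x.submodule), s (c • w) = c ^ k * s w}
  add_mem' := by
    intro s t hs ht c w
    simp only [Pi.add_apply, hs c w, ht c w]
    ring
  zero_mem' := by intro c w; simp
  smul_mem' := by
    intro r s hs c w
    simp only [Pi.smul_apply, hs c w, smul_eq_mul]
    ring

/-- The line bundle `O(k)` on `S`, pulled back from `ℙ^n`. -/
def lineBundle (k : ℕ) (S : Set (AffProj m n)) : RegBundle S where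
  fibre p := lineFun k p.1.x
  IsRegAt p s := ∃ (d : ℕ) (P Q : BiPoly m n), P.IsHomogeneous (d + k) ∧ Q.IsHomogeneous d ∧
    evp Q p.1 ≠ 0 ∧ ∀ᶠ q : S in 𝓝 p, ∀ w : q.1.x.submodule,
      (s q).1 w * ev Q q.1.a w.1 = ev P q.1.a w.1

/-- The twist `E(1)`. -/
def RegBundle.twist {S : Set (AffProj m n)} (E : RegBundle S) : RegBundle S := E.tensor (lineBundle 1 S)

/-- The subbundle of the tangent bundle of the vectors along the fibres of `pr`. On an open subset
of `ℂ^m × ℙ^n`, the projection `pr = AffProj.a` gives `{0} ⊕ Tℙ^n` and `pr = AffProj.x` gives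
`Tℂ^m ⊕ {0}`. -/
def relTangentBundle {B : Type} (pr : AffProj m n → B) (S : Set (AffProj m n)) : RegBundle S :=
  (tangentBundle S).sub (relTangentSpace pr S)

/-- The product `lineFun j × lineFun k → lineFun (j + k)`. -/
def lineMul {x : ℙ ℂ (Fin (n + 1) → ℂ)} (j k : ℕ) :
    lineFun j x →ₗ[ℂ] lineFun k x →ₗ[ℂ] lineFun (j + k) x :=
  LinearMap.mk₂ ℂ (fun s t => ⟨fun w => s.1 w * t.1 w, fun c w => by
      change s.1 (c • w) * t.1 (c • w) = c ^ (j + k) * (s.1 w * t.1 w)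
      rw [s.2 c w, t.2 c w]; ring⟩)
    (fun s s' t => Subtype.ext (funext fun w => add_mul _ _ _))
    (fun c s t => Subtype.ext (funext fun w => mul_assoc _ _ _))
    (fun s t t' => Subtype.ext (funext fun w => mul_add _ _ _))
    (fun c s t => Subtype.ext (funext fun w => mul_left_comm _ _ _))

/-! ### The family of hypersurfaces -/

/-- `H⁰(O_{ℙ^n}(k))`: the forms of degree `k` in `n + 1` variables. -/
abbrev Form (n k : ℕ) := homogeneousSubmodule (Fin (n + 1)) ℂ k

/-- The zero locus in `ℙ^n` of a form. -/
def projZeros {k : ℕ} (f : Form n k) : Set (ℙ ℂ (Fin (n + 1) → ℂ)) :=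
  {x | eval x.rep f.1 = 0}

/-- The hypersurface `f = 0` in `ℙ^n` is smooth. -/
def IsSmoothForm (f : MvPolynomial (Fin (n + 1)) ℂ) : Prop :=
  ∀ w : Fin (n + 1) → ℂ, w ≠ 0 → eval w f = 0 → ∃ j, eval w (pderiv j f) ≠ 0

lemma eval_smul_form {k : ℕ} (f : Form n k) (c : ℂ) (w : Fin (n + 1) → ℂ) :
    eval (c • w) f.1 = c ^ k * eval w f.1 := by
  have hf : f.1.IsHomogeneous k := (mem_homogeneousSubmodule k f.1).1 f.2
  rw [eval_eq, eval_eq, Finset.mul_sum]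
  refine Finset.sum_congr rfl fun d hd => ?_
  have hk : ∑ i ∈ d.support, d i = k := by
    have := hf (mem_support_iff.1 hd)
    rwa [Finsupp.weight_apply, Finsupp.sum, Finset.sum_congr rfl
      (fun i _ => by simp : ∀ i ∈ d.support, d i • (1 : Fin (n + 1) → ℕ) i = d i)] at this
  simp only [Pi.smul_apply, smul_eq_mul, mul_pow, Finset.prod_mul_distrib]
  rw [Finset.prod_pow_eq_pow_sum, hk]
  ring

/-- The value in the fibre of `O(k)` of a form of degree `k`. -/
def formAt {k : ℕ} (f : Form n k) (x : ℙ ℂ (Fin (n + 1) → ℂ)) : lineFun k x :=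
  ⟨fun w => eval w.1 f.1, fun c w => eval_smul_form f c w.1⟩

lemma evp_map_C (f : MvPolynomial (Fin (n + 1)) ℂ) (q : AffProj m n) :
    evp (map C f : BiPoly m n) q = eval q.x.rep f := by
  have : (eval q.a).comp (C : ℂ →+* MvPolynomial (Fin m) ℂ) = RingHom.id ℂ := by
    ext r; simp
  rw [evp, ev, MvPolynomial.map_map, this, MvPolynomial.map_id]

/-- The function `f / Q` on `S`, regular where `Q ≠ 0`. -/
def ratio {k : ℕ} (S : Set (AffProj m n)) (p : S) (f Q : Form n k)
    (hQ : eval p.1.x.rep Q.1 ≠ 0) : regAt S p :=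
  ⟨fun q => eval q.1.x.rep f.1 / eval q.1.x.rep Q.1, k, map C f.1, map C Q.1,
    IsHomogeneous.map ((mem_homogeneousSubmodule k f.1).1 f.2) _,
    IsHomogeneous.map ((mem_homogeneousSubmodule k Q.1).1 Q.2) _,
    by rwa [evp_map_C],
    Eventually.of_forall fun q => by rw [evp_map_C, evp_map_C]⟩

section Family

variable {h : ℕ} (f₀ : Form n h) (L : Fin (h + 1) → Form n 1)

/-- The product `L_0 ⋯ L_h` with `L_i` omitted. -/
def omitProd (i : Fin (h + 1)) : Form n h :=
  ⟨∏ j ∈ Finset.univ.erase i, (L j).1, by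
    have := IsHomogeneous.prod (Finset.univ.erase i) (fun j => (L j).1) (fun _ => 1)
      (fun j _ => (mem_homogeneousSubmodule 1 (L j).1).1 (L j).2)
    simpa [mem_homogeneousSubmodule] using this⟩

/-- The member `f_0 + ∑ a_i L_0 ⋯ L̂_i ⋯ L_h` of the family. -/
def member (a : Fin (h + 1) → ℂ) : Form n h := f₀ + ∑ i, a i • omitProd L i

/-- `A`: the parameters of the smooth hypersurfaces of the family. -/
def parA : Set (Fin (h + 1) → ℂ) := {a | IsSmoothForm (member f₀ L a).1}

/-- `W`: the complement of the union of the `{L_i = L_j = 0}`, `i < j`. -/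
def openW : Set (ℙ ℂ (Fin (n + 1) → ℂ)) :=
  {x | ∀ i j, i < j → ¬ (x ∈ projZeros (L i) ∧ x ∈ projZeros (L j))}

/-- `A × W`. -/
def prodAW : Set (AffProj (h + 1) n) := {p | p.a ∈ parA f₀ L ∧ p.x ∈ openW L}

/-- `X_W`: the part over `W` of the universal hypersurface. -/
def XW : Set (AffProj (h + 1) n) := {p | p ∈ prodAW f₀ L ∧ p.x ∈ projZeros (member f₀ L p.a)}

lemma XW_subset : XW f₀ L ⊆ prodAW f₀ L := fun _ hp => hp.1

/-- `T X_W(1)`. -/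
def TXW1 : RegBundle (XW f₀ L) := (tangentBundle (XW f₀ L)).twist

/-- The relative tangent bundle `T_{W/A}(1)` of `A × W`, restricted to `X_W`. -/
def TWA1 : RegBundle (XW f₀ L) :=
  ((relTangentBundle AffProj.a (prodAW f₀ L)).twist).restrict (XW_subset f₀ L)

/-- The relative tangent bundle `T_{A/W}(1)` of `A × W`, restricted to `X_W`. -/
def TAW1 : RegBundle (XW f₀ L) :=
  ((relTangentBundle AffProj.x (prodAW f₀ L)).twist).restrict (XW_subset f₀ L)

/-- The section `u_i = L_0 ∂/∂a_0 - L_i ∂/∂a_i`, `i = 1, …, h`, of the twisted tangent bundle of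
`ℂ^(h+1) × ℙ^n`. The index `i = 1, …, h` is `i.succ` with `i : Fin h`. -/
def uField (p : (Set.univ : Set (AffProj (h + 1) n))) (i : Fin h) :
    ((tangentBundle Set.univ).twist (S := Set.univ)).fibre p :=
  (partialA p 0 ⊗ₜ[ℂ] formAt (L 0) p.1.x - partialA p i.succ ⊗ₜ[ℂ] formAt (L i.succ) p.1.x :
    tangentSpace Set.univ p ⊗[ℂ] lineFun 1 p.1.x)

/-- The differential `T_p X_W(1) → T_p(ℂ^(h+1) × ℙ^n)(1)` of the inclusion. -/
def inclTotal (p : XW f₀ L) : (TXW1 f₀ L).fibre p →ₗ[ℂ]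
    ((tangentBundle Set.univ).twist (S := Set.univ)).fibre
      (Set.inclusion (Set.subset_univ (XW f₀ L)) p) :=
  LinearMap.rTensor (lineFun 1 p.1.x) (dIncl (Set.subset_univ (XW f₀ L)) p)

/-- The differential `T_p X_W(1) → T_p(A × W)(1)` of the inclusion. -/
def inclAW (p : XW f₀ L) : (TXW1 f₀ L).fibre p →ₗ[ℂ]
    ((tangentBundle (prodAW f₀ L)).twist).fibre (Set.inclusion (XW_subset f₀ L) p) :=
  LinearMap.rTensor (lineFun 1 p.1.x) (dIncl (XW_subset f₀ L) p)

/-- `G(1)`: the vectors of `T X_W(1)` in the span of the `u_i`. -/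
def G1 (p : XW f₀ L) : Submodule ℂ ((TXW1 f₀ L).fibre p) :=
  (Submodule.span ℂ (Set.range (uField L (Set.inclusion (Set.subset_univ (XW f₀ L)) p)))).comap
    (inclTotal f₀ L p)

/-- The inclusion `T_{W/A}(1) ⊆ T(A × W)(1)` at a point of `X_W`. -/
def inclW (p : XW f₀ L) : (TWA1 f₀ L).fibre p →ₗ[ℂ]
    ((tangentBundle (prodAW f₀ L)).twist).fibre (Set.inclusion (XW_subset f₀ L) p) :=
  LinearMap.rTensor (lineFun 1 p.1.x)
    (relTangentSpace AffProj.a (prodAW f₀ L) (Set.inclusion (XW_subset f₀ L) p)).subtype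

/-- The inclusion `T_{A/W}(1) ⊆ T(A × W)(1)` at a point of `X_W`. -/
def inclA (p : XW f₀ L) : (TAW1 f₀ L).fibre p →ₗ[ℂ]
    ((tangentBundle (prodAW f₀ L)).twist).fibre (Set.inclusion (XW_subset f₀ L) p) :=
  LinearMap.rTensor (lineFun 1 p.1.x)
    (relTangentSpace AffProj.x (prodAW f₀ L) (Set.inclusion (XW_subset f₀ L) p)).subtype

/-- The derivative of the universal polynomial along the `A`-component:
`T_p X_W → O(h)`, `D ↦ ∑ D(a_i) ∂F/∂a_i` with `∂F/∂a_i = L_0 ⋯ L̂_i ⋯ L_h`. -/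
def muOne (p : XW f₀ L) : tangentSpace (XW f₀ L) p →ₗ[ℂ] lineFun h p.1.x where
  toFun D := ∑ i, D.1 (coordA (XW f₀ L) p i) • formAt (omitProd L i) p.1.x
  map_add' D E := by simp [add_smul, Finset.sum_add_distrib]
  map_smul' c D := by simp [mul_smul, Finset.smul_sum]

/-- `μ : T X_W(1) → O(h + 1)`, the twist of `muOne`. -/
def mu (p : XW f₀ L) : (TXW1 f₀ L).fibre p →ₗ[ℂ] lineFun (h + 1) p.1.x :=
  TensorProduct.lift ((lineMul h 1).comp (muOne f₀ L p))

/-- The derivative `D ↦ ∂f_0/∂D ∈ O(h)` of the section `f_0` of `O(h)` at one of its zeros, along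
vectors `D` in `T_{W/A}`, in the local trivialization of `O(h)` by `Q`. -/
def nuOne (p : XW f₀ L) (Q : Form n h) (hQ : eval p.1.x.rep Q.1 ≠ 0) :
    relTangentSpace AffProj.a (prodAW f₀ L) (Set.inclusion (XW_subset f₀ L) p) →ₗ[ℂ]
      lineFun h p.1.x where
  toFun D := D.1.1 (ratio (prodAW f₀ L) (Set.inclusion (XW_subset f₀ L) p) f₀ Q hQ) •
    formAt Q p.1.x
  map_add' D E := by simp [add_smul]
  map_smul' c D := by simp [mul_smul]

/-- `ν : T_{W/A}(1) → O(h + 1)`, the twist of `nuOne`. -/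
def nu (p : XW f₀ L) (Q : Form n h) (hQ : eval p.1.x.rep Q.1 ≠ 0) :
    (TWA1 f₀ L).fibre p →ₗ[ℂ] lineFun (h + 1) p.1.x :=
  TensorProduct.lift ((lineMul h 1).comp (nuOne f₀ L p Q hQ))

end Family

end ClemensFamily

end

open ClemensFamily

/-!
At a point of `W` some `M_i = ∏_{j ≠ i} L_j` is nonzero, because at most one `L_j` vanishes there.
Near such a point the equation `f_0 + ∑ a_l M_l = 0` of `X_W` can be solved for `a_i`, so the other
`a_l` and affine coordinates of `ℙ^n` are local coordinates on `X_W`. Hence `T X_W → T W` is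
surjective, and its kernel is the hyperplane `∑ M_l α_l = 0` of `T A`, which is spanned by the
vectors `L_0 e_0 - L_i e_i`. This gives `T X_W(1) / G(1) ≅ T_{W/A}(1)`; the sign of `α + v ↦ -v`
makes the differentials correspond, since differentiating the equation along `α + v` at `a = 0`
gives `∂f_0/∂v + ∑ α_l M_l = 0`.

Tangent vectors are derivations of local rings. They are determined by their values on the
coordinate functions of a chart, and vectors with prescribed values are derivatives along
holomorphic curves. The curves stay in `A × W` because `A` is open in the Euclidean topology, by
compactness of the unit sphere of `ℂ^(n+1)`.
-/

noncomputable section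

namespace ClemensFamily

/-! ### Regular functions in affine charts -/

section RegularFunctions

variable {m n : ℕ} {S : Set (AffProj m n)} {p : S} {f g : S → ℂ}

lemma IsRegularAt.congr (hf : IsRegularAt S p f) (h : f =ᶠ[𝓝 p] g) : IsRegularAt S p g := by
  obtain ⟨d, P, Q, hP, hQ, h0, hf⟩ := hf
  exact ⟨d, P, Q, hP, hQ, h0, h.symm.trans hf⟩

lemma IsRegularAt.eventually (hf : IsRegularAt S p f) : ∀ᶠ q in 𝓝 p, IsRegularAt S q f := by
  obtain ⟨d, P, Q, hP, hQ, h0, hf⟩ := hf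
  filter_upwards [hf.eventually_nhds, eventually_evp_ne p hQ h0] with q hq hQq
  exact ⟨d, P, Q, hP, hQ, hQq, hq⟩

lemma IsRegularAt.eventually_ne (hf : IsRegularAt S p f) (h : f p ≠ 0) :
    ∀ᶠ q in 𝓝 p, f q ≠ 0 := by
  obtain ⟨d, P, Q, hP, hQ, h0, hf⟩ := hf
  have hPp : evp P p.1 ≠ 0 := (div_ne_zero_iff.1 (hf.self_of_nhds ▸ h)).1
  filter_upwards [hf, eventually_evp_ne p hQ h0, eventually_evp_ne p hP hPp] with q hq hQq hPq
  exact hq ▸ div_ne_zero hPq hQq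

lemma IsRegularAt.inv (hf : IsRegularAt S p f) (h : f p ≠ 0) : IsRegularAt S p f⁻¹ := by
  obtain ⟨d, P, Q, hP, hQ, -, hf⟩ := hf
  refine ⟨d, Q, P, hQ, hP, (div_ne_zero_iff.1 (hf.self_of_nhds ▸ h)).1, ?_⟩
  filter_upwards [hf] with q hq
  rw [Pi.inv_apply, hq, inv_div]

lemma IsRegularAt.add (hf : IsRegularAt S p f) (hg : IsRegularAt S p g) :
    IsRegularAt S p (f + g) := (regAt S p).add_mem hf hg

lemma IsRegularAt.mul (hf : IsRegularAt S p f) (hg : IsRegularAt S p g) :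
    IsRegularAt S p (f * g) := (regAt S p).mul_mem hf hg

lemma IsRegularAt.neg (hf : IsRegularAt S p f) : IsRegularAt S p (-f) := (regAt S p).neg_mem hf

lemma isRegularAt_const (p : S) (c : ℂ) : IsRegularAt S p fun _ => c :=
  (regAt S p).algebraMap_mem c

lemma IsRegularAt.sum {ι : Type*} {s : Finset ι} {f : ι → S → ℂ}
    (hf : ∀ i ∈ s, IsRegularAt S p (f i)) : IsRegularAt S p (∑ i ∈ s, f i) :=
  (regAt S p).sum_mem hf

lemma IsRegularAt.comp_inclusion {Z : Set (AffProj m n)} (h : S ⊆ Z) {f : Z → ℂ}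
    (hf : IsRegularAt Z (Set.inclusion h p) f) : IsRegularAt S p (f ∘ Set.inclusion h) :=
  (restrictFun h p ⟨f, hf⟩).2

/-- The affine coordinate function `a_i` on `S`. -/
def affineCoord (S : Set (AffProj m n)) (i : Fin m) : S → ℂ := fun q => q.1.a i

/-- The function `f / Q` on `S`, for forms `f` and `Q` of the same degree; its value is `0` where
`Q` vanishes. -/
def formRatio (S : Set (AffProj m n)) {d : ℕ} (f Q : Form n d) : S → ℂ :=
  fun q => eval q.1.x.rep f.1 / eval q.1.x.rep Q.1

/-- The homogeneous coordinate `x_j`, as a linear form. -/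
def varForm (j : Fin (n + 1)) : Form n 1 :=
  ⟨X j, (mem_homogeneousSubmodule _ _).2 (isHomogeneous_X _ _)⟩

/-- The `n` coordinate functions `x_l / x_k`, `l ≠ k`, of the affine chart `x_k ≠ 0`. The index
`l ≠ k` is `k.succAbove j` with `j : Fin n`. -/
def chartCoord (S : Set (AffProj m n)) (k : Fin (n + 1)) (j : Fin n) : S → ℂ :=
  formRatio S (varForm (k.succAbove j)) (varForm k)

@[simp] lemma eval_varForm (j : Fin (n + 1)) (w : Fin (n + 1) → ℂ) :
    eval w (varForm j).1 = w j := by simp [varForm]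

lemma isRegularAt_affineCoord (p : S) (i : Fin m) : IsRegularAt S p (affineCoord S i) :=
  (coordA S p i).2

lemma isRegularAt_formRatio {d : ℕ} (f : Form n d) {Q : Form n d} (hQ : eval p.1.x.rep Q.1 ≠ 0) :
    IsRegularAt S p (formRatio S f Q) := (ratio S p f Q hQ).2

lemma isRegularAt_chartCoord {k : Fin (n + 1)} (hk : p.1.x.rep k ≠ 0) (j : Fin n) :
    IsRegularAt S p (chartCoord S k j) := isRegularAt_formRatio _ (by simpa using hk)

lemma eventually_eval_rep_ne {d : ℕ} {Q : Form n d} (hQ : eval p.1.x.rep Q.1 ≠ 0) :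
    ∀ᶠ q : S in 𝓝 p, eval q.1.x.rep Q.1 ≠ 0 := by
  have hQ' := ((mem_homogeneousSubmodule d Q.1).1 Q.2).map (C : ℂ →+* MvPolynomial (Fin m) ℂ)
  simpa only [evp_map_C] using eventually_evp_ne p hQ' (by rwa [evp_map_C])

lemma eventually_rep_ne {k : Fin (n + 1)} (hk : p.1.x.rep k ≠ 0) :
    ∀ᶠ q : S in 𝓝 p, q.1.x.rep k ≠ 0 := by
  simpa using eventually_eval_rep_ne (Q := varForm k) (by simpa using hk)

lemma exists_rep_ne (x : ℙ ℂ (Fin (n + 1) → ℂ)) : ∃ k, x.rep k ≠ 0 :=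
  Function.ne_iff.1 x.rep_nonzero

lemma ev_smul {P : BiPoly m n} {d : ℕ} (hP : P.IsHomogeneous d) (a : Fin m → ℂ) (c : ℂ)
    (w : Fin (n + 1) → ℂ) : ev P a (c • w) = c ^ d * ev P a w :=
  eval_smul_form ⟨map (eval a) P, (mem_homogeneousSubmodule _ _).2 (hP.map _)⟩ c w

lemma smul_insertNth_chartCoord {k : Fin (n + 1)} (hk : p.1.x.rep k ≠ 0) :
    p.1.x.rep k • k.insertNth (1 : ℂ) (fun j => chartCoord S k j p) = p.1.x.rep := by
  refine funext (Fin.succAboveCases k ?_ fun j => ?_)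
  · simp
  · simp [chartCoord, formRatio, mul_div_cancel₀ _ hk]

lemma evp_eq_pow_mul_ev {P : BiPoly m n} {d : ℕ} (hP : P.IsHomogeneous d) {k : Fin (n + 1)}
    (hk : p.1.x.rep k ≠ 0) :
    evp P p.1 = p.1.x.rep k ^ d *
      ev P p.1.a (k.insertNth (1 : ℂ) fun j => chartCoord S k j p) := by
  rw [← ev_smul hP, smul_insertNth_chartCoord hk, evp]

theorem isRegularAt_induction {k : Fin (n + 1)} (hk : p.1.x.rep k ≠ 0) {M : (S → ℂ) → Prop}
    (const : ∀ c, M fun _ => c) (affine : ∀ i, M (affineCoord S i))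
    (chart : ∀ j, M (chartCoord S k j)) (sum : ∀ f g, M f → M g → M (f + g))
    (prod : ∀ f g, M f → M g → M (f * g)) (inv : ∀ f, M f → f p ≠ 0 → M f⁻¹)
    (congr : ∀ f g, M f → f =ᶠ[𝓝 p] g → M g) (hf : IsRegularAt S p f) : M f := by
  have coeff (R : MvPolynomial (Fin m) ℂ) : M fun q => eval q.1.a R := by
    induction R using MvPolynomial.induction_on with
    | C r => simpa using const r
    | add R R' h h' => simp only [map_add]; exact sum _ _ h h'
    | mul_X R i h => simp only [map_mul, eval_X]; exact prod _ _ h (affine i)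
  have coord : ∀ l, M fun q =>
      (k.insertNth 1 (fun j => chartCoord S k j q) : Fin (n + 1) → ℂ) l :=
    Fin.succAboveCases k (by simpa using const 1) fun j => by simpa using chart j
  have poly (P : BiPoly m n) :
      M fun q => ev P q.1.a (k.insertNth 1 fun j => chartCoord S k j q) := by
    induction P using MvPolynomial.induction_on with
    | C R => simpa [ev] using coeff R
    | add P P' h h' => simp only [ev, map_add] at *; exact sum _ _ h h'
    | mul_X P l h => simp only [ev, map_mul, map_X, eval_X] at *; exact prod _ _ h (coord l)
  obtain ⟨d, P, Q, hP, hQ, hQp, hf⟩ := hf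
  rw [evp_eq_pow_mul_ev hQ hk] at hQp
  refine congr _ _ (prod _ _ (poly P) (inv _ (poly Q) (right_ne_zero_of_mul hQp))) ?_
  filter_upwards [hf, eventually_rep_ne hk] with q hq hkq
  rw [hq, evp_eq_pow_mul_ev hP hkq, evp_eq_pow_mul_ev hQ hkq,
    mul_div_mul_left _ _ (pow_ne_zero _ hkq)]
  exact (div_eq_mul_inv _ _).symm

end RegularFunctions

/-! ### Tangent vectors in coordinates -/

section TangentVectors

variable {m n : ℕ} {S : Set (AffProj m n)} {p : S} {f g : S → ℂ} {k : Fin (n + 1)}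

open Classical in
/-- The differential at `p` of a function `f`, as a linear form on the tangent space; it is `0` by
convention if `f` is not regular at `p`. -/
def dFun (f : S → ℂ) (p : S) : tangentSpace S p →ₗ[ℂ] ℂ where
  toFun D := if hf : f ∈ regAt S p then D.1 ⟨f, hf⟩ else 0
  map_add' D E := by split_ifs <;> simp
  map_smul' c D := by split_ifs <;> simp

lemma dFun_apply (hf : IsRegularAt S p f) (D : tangentSpace S p) : dFun f p D = D.1 ⟨f, hf⟩ :=
  dif_pos hf

lemma dFun_add (hf : IsRegularAt S p f) (hg : IsRegularAt S p g) :
    dFun (f + g) p = dFun f p + dFun g p := by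
  ext D
  rw [LinearMap.add_apply, dFun_apply (hf.add hg), dFun_apply hf, dFun_apply hg, ← map_add]
  rfl

lemma dFun_mul (hf : IsRegularAt S p f) (hg : IsRegularAt S p g) :
    dFun (f * g) p = f p • dFun g p + g p • dFun f p := by
  ext D
  simp only [LinearMap.add_apply, LinearMap.smul_apply, smul_eq_mul, dFun_apply (hf.mul hg),
    dFun_apply hf, dFun_apply hg]
  exact D.2 ⟨f, hf⟩ ⟨g, hg⟩

lemma dFun_const (c : ℂ) : dFun (fun _ => c) p = 0 := by
  have h1 : dFun (fun _ => (1 : ℂ)) p = 0 := by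
    have h := dFun_mul (isRegularAt_const p 1) (isRegularAt_const p 1)
    have hone : (fun _ : S => (1 : ℂ)) * (fun _ => 1) = fun _ => 1 := funext fun _ => mul_one 1
    rw [hone, one_smul] at h
    exact left_eq_add.1 h
  ext D
  have h := D.1.map_smul c ⟨_, isRegularAt_const p 1⟩
  rw [← dFun_apply, h1, LinearMap.zero_apply, smul_zero] at h
  rw [dFun_apply (isRegularAt_const p c), LinearMap.zero_apply, ← h]
  exact congrArg D.1 (Subtype.ext (funext fun _ => (mul_one c).symm))

lemma dFun_sum {ι : Type*} {s : Finset ι} {f : ι → S → ℂ} (hf : ∀ i ∈ s, IsRegularAt S p (f i)) :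
    dFun (∑ i ∈ s, f i) p = ∑ i ∈ s, dFun (f i) p := by
  classical
  induction s using Finset.induction_on with
  | empty => exact dFun_const 0
  | insert i s hi ih =>
    have hs := fun j hj => hf j (Finset.mem_insert_of_mem hj)
    rw [Finset.sum_insert hi, Finset.sum_insert hi,
      dFun_add (hf i (Finset.mem_insert_self i s)) (IsRegularAt.sum hs), ih hs]

/-- If `f` vanishes near `p` and `u` is the indicator function of `f ≠ 0`, then `f = u * f` with
both factors vanishing at `p`. -/
lemma dFun_eq_zero_of_eventuallyEq (h : f =ᶠ[𝓝 p] fun _ => 0) : dFun f p = 0 := by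
  classical
  let u : S → ℂ := fun q => if f q = 0 then 0 else 1
  have hu : u =ᶠ[𝓝 p] fun _ => 0 := h.mono fun q hq => if_pos hq
  have huf : u * f = f := by
    ext q
    by_cases hq : f q = 0 <;> simp [u, hq]
  rw [← huf, dFun_mul ((isRegularAt_const p 0).congr hu.symm)
    ((isRegularAt_const p 0).congr h.symm), hu.self_of_nhds, h.self_of_nhds]
  simp

lemma dFun_congr (hf : IsRegularAt S p f) (h : f =ᶠ[𝓝 p] g) : dFun f p = dFun g p := by
  have hgf : g + -f =ᶠ[𝓝 p] fun _ => 0 := h.mono fun q hq => by simp [hq]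
  rw [← add_zero (dFun f p), ← dFun_eq_zero_of_eventuallyEq hgf,
    ← dFun_add hf ((hf.congr h).add hf.neg), add_left_comm, add_neg_cancel, add_zero]

lemma dFun_inv (hf : IsRegularAt S p f) (h : f p ≠ 0) :
    dFun f⁻¹ p = -((f p)⁻¹ * (f p)⁻¹) • dFun f p := by
  have hone : (fun _ => (1 : ℂ)) =ᶠ[𝓝 p] f * f⁻¹ :=
    (hf.eventually_ne h).mono fun q hq => (mul_inv_cancel₀ hq).symm
  have hd := dFun_congr (isRegularAt_const p 1) hone
  rw [dFun_const, dFun_mul hf (hf.inv h), Pi.inv_apply] at hd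
  rw [neg_smul, mul_smul, ← smul_neg, eq_inv_smul_iff₀ h]
  exact eq_neg_of_add_eq_zero_left hd.symm

/-- The components `D(a_i)` of a tangent vector `D`. -/
def dA (p : S) : tangentSpace S p →ₗ[ℂ] Fin m → ℂ := LinearMap.pi fun i => dFun (affineCoord S i) p

/-- The components of a tangent vector along the coordinates `x_l / x_k`, `l ≠ k`, of the chart
`x_k ≠ 0`. -/
def dChart (k : Fin (n + 1)) (p : S) : tangentSpace S p →ₗ[ℂ] Fin n → ℂ :=
  LinearMap.pi fun j => dFun (chartCoord S k j) p

lemma tangent_ext (hk : p.1.x.rep k ≠ 0) {D E : tangentSpace S p} (ha : dA p D = dA p E)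
    (hx : dChart k p D = dChart k p E) : D = E := by
  have key {f : S → ℂ} (hf : IsRegularAt S p f) :
      IsRegularAt S p f ∧ dFun f p D = dFun f p E := by
    refine isRegularAt_induction (M := fun f => IsRegularAt S p f ∧ dFun f p D = dFun f p E) hk
      (fun c => ⟨isRegularAt_const p c, by simp only [dFun_const, LinearMap.zero_apply]⟩)
      (fun i => ⟨isRegularAt_affineCoord p i, congrFun ha i⟩)
      (fun j => ⟨isRegularAt_chartCoord hk j, congrFun hx j⟩) ?_ ?_ ?_ ?_ hf
    · rintro f g ⟨hf, hfE⟩ ⟨hg, hgE⟩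
      exact ⟨hf.add hg, by simp only [dFun_add hf hg, LinearMap.add_apply, hfE, hgE]⟩
    · rintro f g ⟨hf, hfE⟩ ⟨hg, hgE⟩
      refine ⟨hf.mul hg, ?_⟩
      simp only [dFun_mul hf hg, LinearMap.add_apply, LinearMap.smul_apply, hfE, hgE]
    · rintro f ⟨hf, hfE⟩ h0
      exact ⟨hf.inv h0, by simp only [dFun_inv hf h0, LinearMap.smul_apply, hfE]⟩
    · rintro f g ⟨hf, hfE⟩ hfg
      exact ⟨hf.congr hfg, by rw [← dFun_congr hf hfg, hfE]⟩
  ext f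
  have h := (key f.2).2
  rwa [dFun_apply f.2, dFun_apply f.2] at h

lemma isRegAt_of_dA_of_dChart {s : ∀ q, tangentSpace S q} (hk : p.1.x.rep k ≠ 0)
    (ha : ∀ i, IsRegularAt S p fun q => dA q (s q) i)
    (hx : ∀ j, IsRegularAt S p fun q => dChart k q (s q) j) : (tangentBundle S).IsRegAt p s := by
  intro f hf
  refine (isRegularAt_induction (M := fun f => IsRegularAt S p f ∧
    IsRegularAt S p fun q => dFun f q (s q)) hk ?_ (fun i => ⟨isRegularAt_affineCoord p i, ha i⟩)
    (fun j => ⟨isRegularAt_chartCoord hk j, hx j⟩) ?_ ?_ ?_ ?_ hf).2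
  · intro c
    exact ⟨isRegularAt_const p c, by simpa [dFun_const] using isRegularAt_const p 0⟩
  · rintro f g ⟨hf, hfs⟩ ⟨hg, hgs⟩
    refine ⟨hf.add hg, (hfs.add hgs).congr ?_⟩
    filter_upwards [hf.eventually, hg.eventually] with q hfq hgq
    simp [dFun_add hfq hgq]
  · rintro f g ⟨hf, hfs⟩ ⟨hg, hgs⟩
    refine ⟨hf.mul hg, ((hf.mul hgs).add (hg.mul hfs)).congr ?_⟩
    filter_upwards [hf.eventually, hg.eventually] with q hfq hgq
    simp [dFun_mul hfq hgq]
  · rintro f ⟨hf, hfs⟩ h0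
    refine ⟨hf.inv h0, (((hf.inv h0).mul (hf.inv h0)).mul hfs).neg.congr ?_⟩
    filter_upwards [hf.eventually, hf.eventually_ne h0] with q hfq hq
    simp [dFun_inv hfq hq]
  · rintro f g ⟨hf, hfs⟩ hfg
    refine ⟨hf.congr hfg, hfs.congr ?_⟩
    filter_upwards [hf.eventually, hfg.eventually_nhds] with q hfq hq
    rw [dFun_congr hfq hq]

lemma isRegularAt_dFun {s : ∀ q, tangentSpace S q} (hs : (tangentBundle S).IsRegAt p s)
    (hf : IsRegularAt S p f) : IsRegularAt S p fun q => dFun f q (s q) := hs f hf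

variable {Z : Set (AffProj m n)} (h : S ⊆ Z)

lemma dFun_dIncl {f : Z → ℂ} (hf : IsRegularAt Z (Set.inclusion h p) f) (D : tangentSpace S p) :
    dFun f (Set.inclusion h p) (dIncl h p D) = dFun (f ∘ Set.inclusion h) p D := by
  rw [dFun_apply hf, dFun_apply (hf.comp_inclusion h)]
  rfl

lemma dA_dIncl (D : tangentSpace S p) : dA (Set.inclusion h p) (dIncl h p D) = dA p D :=
  funext fun i => dFun_dIncl h (isRegularAt_affineCoord _ i) D

lemma dChart_dIncl (hk : p.1.x.rep k ≠ 0) (D : tangentSpace S p) :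
    dChart k (Set.inclusion h p) (dIncl h p D) = dChart k p D :=
  funext fun j => dFun_dIncl h (isRegularAt_chartCoord (p := Set.inclusion h p) hk j) D

lemma dIncl_injective (p : S) : Function.Injective (dIncl h p) := by
  intro D E hDE
  obtain ⟨k, hk⟩ := exists_rep_ne p.1.x
  exact tangent_ext hk (by rw [← dA_dIncl h D, hDE, dA_dIncl])
    (by rw [← dChart_dIncl h hk D, hDE, dChart_dIncl h hk])

end TangentVectors

/-! ### Tangent vectors of curves -/

section Curves

variable {m n : ℕ} {S : Set (AffProj m n)} {p : S}

/-- The cone over `S` in `ℂ^m × (ℂ^(n+1) ∖ 0)`. -/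
def cone (S : Set (AffProj m n)) : Set ((Fin m → ℂ) × (Fin (n + 1) → ℂ)) :=
  {z | ∃ hz : z.2 ≠ 0, ⟨z.1, .mk ℂ z.2 hz⟩ ∈ S}

/-- The image in `S` of a point of the cone over `S`. -/
def coneMk {z : (Fin m → ℂ) × (Fin (n + 1) → ℂ)} (hz : z ∈ cone S) : S := ⟨_, hz.snd⟩

/-- A point of `S`, lifted to the cone over `S`. -/
def coneLift (p : S) : (Fin m → ℂ) × (Fin (n + 1) → ℂ) := (p.1.a, p.1.x.rep)

open Classical in
/-- A function on `S`, pulled back to the cone over `S` and extended by `0`. -/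
def onCone (f : S → ℂ) (z : (Fin m → ℂ) × (Fin (n + 1) → ℂ)) : ℂ :=
  if hz : z ∈ cone S then f (coneMk hz) else 0

lemma onCone_of_mem {z : (Fin m → ℂ) × (Fin (n + 1) → ℂ)} (hz : z ∈ cone S) (f : S → ℂ) :
    onCone f z = f (coneMk hz) := dif_pos hz

lemma coneLift_mem (p : S) : coneLift p ∈ cone S :=
  ⟨p.1.x.rep_nonzero, by simpa only [coneLift, Projectivization.mk_rep] using p.2⟩

lemma coneMk_coneLift (p : S) : coneMk (coneLift_mem p) = p :=
  Subtype.ext (AffProj.ext rfl (Projectivization.mk_rep _))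

lemma onCone_coneLift (f : S → ℂ) (p : S) : onCone f (coneLift p) = f p := by
  rw [onCone_of_mem (coneLift_mem p), coneMk_coneLift]

lemma onCone_add (f g : S → ℂ) : onCone (f + g) = onCone f + onCone g := by
  ext z
  simp only [onCone, Pi.add_apply]
  split_ifs <;> simp

lemma onCone_mul (f g : S → ℂ) : onCone (f * g) = onCone f * onCone g := by
  ext z
  simp only [onCone, Pi.mul_apply]
  split_ifs <;> simp

lemma onCone_smul (c : ℂ) (f : S → ℂ) : onCone (c • f) = c • onCone f := by
  ext z
  simp only [onCone, Pi.smul_apply]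
  split_ifs <;> simp

lemma exists_rep_mk_eq_smul {w : Fin (n + 1) → ℂ} (hw : w ≠ 0) :
    ∃ c : ℂ, c ≠ 0 ∧ (Projectivization.mk ℂ w hw).rep = c • w := by
  obtain ⟨c, hc⟩ := Projectivization.exists_smul_eq_mk_rep ℂ w hw
  exact ⟨c, c.ne_zero, hc.symm⟩

lemma eval_rep_mk_eq_zero_iff {d : ℕ} (f : Form n d) {w : Fin (n + 1) → ℂ} (hw : w ≠ 0) :
    eval (Projectivization.mk ℂ w hw).rep f.1 = 0 ↔ eval w f.1 = 0 := by
  obtain ⟨c, hc, hrep⟩ := exists_rep_mk_eq_smul hw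
  rw [hrep, eval_smul_form]
  simp [hc]

lemma exists_evp_coneMk_eq_mul {z : (Fin m → ℂ) × (Fin (n + 1) → ℂ)} (hz : z ∈ cone S) (d : ℕ) :
    ∃ c : ℂ, c ≠ 0 ∧ ∀ P : BiPoly m n, P.IsHomogeneous d →
      evp P (coneMk hz).1 = c * ev P z.1 z.2 := by
  obtain ⟨c, hc, hrep⟩ := exists_rep_mk_eq_smul hz.fst
  refine ⟨c ^ d, pow_ne_zero d hc, fun P hP => ?_⟩
  change ev P z.1 (Projectivization.mk ℂ z.2 hz.fst).rep = _
  rw [hrep, ev_smul hP]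

lemma onCone_affineCoord {z : (Fin m → ℂ) × (Fin (n + 1) → ℂ)} (hz : z ∈ cone S) (i : Fin m) :
    onCone (affineCoord S i) z = z.1 i := onCone_of_mem hz _

lemma onCone_formRatio {z : (Fin m → ℂ) × (Fin (n + 1) → ℂ)} (hz : z ∈ cone S) {d : ℕ}
    (f Q : Form n d) : onCone (formRatio S f Q) z = eval z.2 f.1 / eval z.2 Q.1 := by
  obtain ⟨c, hc, hrep⟩ := exists_rep_mk_eq_smul hz.fst
  rw [onCone_of_mem hz]
  change eval (Projectivization.mk ℂ z.2 hz.fst).rep f.1 /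
    eval (Projectivization.mk ℂ z.2 hz.fst).rep Q.1 = _
  rw [hrep, eval_smul_form, eval_smul_form, mul_div_mul_left _ _ (pow_ne_zero _ hc)]

lemma differentiable_ev (P : BiPoly m n) :
    Differentiable ℂ fun z : (Fin m → ℂ) × (Fin (n + 1) → ℂ) => ev P z.1 z.2 := by
  induction P using MvPolynomial.induction_on with
  | C R =>
    simp only [ev, map_C, eval_C]
    exact fun z => (AnalyticOnNhd.eval_mvPolynomial R z.1 trivial).differentiableAt.comp z
      differentiableAt_fst
  | add P P' h h' => simp only [ev, map_add] at *; exact h.fun_add h'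
  | mul_X P l h =>
    simp only [ev, map_mul, map_X, eval_X] at *
    exact h.fun_mul (differentiable_pi.1 differentiable_snd l)

lemma continuous_coneMk : Continuous fun z : cone S => coneMk z.2 := by
  refine Continuous.subtype_mk (continuous_generateFrom_iff.2 ?_) _
  rintro _ ⟨d, P, hP, rfl⟩
  convert isOpen_ne_fun ((differentiable_ev P).continuous.comp continuous_subtype_val)
    (continuous_const (y := (0 : ℂ))) using 1
  ext z
  obtain ⟨c, hc, hev⟩ := exists_evp_coneMk_eq_mul z.2 d
  change evp P (coneMk z.2).1 ≠ 0 ↔ ev P z.1.1 z.1.2 ≠ 0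
  rw [hev P hP]
  simp only [ne_eq, mul_eq_zero, hc, false_or]

lemma eventually_coneMk {φ : S → Prop} (hφ : ∀ᶠ q in 𝓝 p, φ q) :
    ∀ᶠ z in 𝓝 (coneLift p), ∀ hz : z ∈ cone S, φ (coneMk hz) := by
  have hev := (continuous_coneMk.continuousAt (x := ⟨_, coneLift_mem p⟩)).eventually (p := φ)
    (by simpa only [coneMk_coneLift] using hφ)
  rw [nhds_subtype, eventually_comap] at hev
  exact hev.mono fun z hz hzS => hz ⟨z, hzS⟩ rfl

section Curve

variable {γ : ℂ → (Fin m → ℂ) × (Fin (n + 1) → ℂ)} (hγ : DifferentiableAt ℂ γ 0)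
  (hγp : γ 0 = coneLift p) (hγS : ∀ᶠ t in 𝓝 0, γ t ∈ cone S)

include hγ hγp hγS in
lemma differentiableAt_onCone_comp {f : S → ℂ} (hf : IsRegularAt S p f) :
    DifferentiableAt ℂ (onCone f ∘ γ) 0 := by
  obtain ⟨d, P, Q, hP, hQ, hQp, hf⟩ := hf
  have hdiff : DifferentiableAt ℂ
      (fun t => ev P (γ t).1 (γ t).2 / ev Q (γ t).1 (γ t).2) 0 := by
    refine ((differentiable_ev P _).comp 0 hγ).fun_div ((differentiable_ev Q _).comp 0 hγ) ?_
    rwa [hγp]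
  refine hdiff.congr_of_eventuallyEq ?_
  have hlim : Tendsto γ (𝓝 0) (𝓝 (coneLift p)) := hγp ▸ hγ.continuousAt.tendsto
  filter_upwards [hγS, hlim.eventually (eventually_coneMk hf)] with t htS ht
  obtain ⟨c, hc, hev⟩ := exists_evp_coneMk_eq_mul htS d
  rw [Function.comp_apply, onCone_of_mem htS, ht htS, hev P hP, hev Q hQ,
    mul_div_mul_left _ _ hc]

include hγ hγp hγS in
theorem exists_tangent_of_curve : ∃ D : tangentSpace S p, ∀ f, IsRegularAt S p f →
    HasDerivAt (onCone f ∘ γ) (dFun f p D) 0 := by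
  have hd (f : regAt S p) := differentiableAt_onCone_comp hγ hγp hγS f.2
  have h0 (f : regAt S p) : onCone f.1 (γ 0) = f.1 p := by rw [hγp, onCone_coneLift]
  refine ⟨⟨{ toFun := fun f => deriv (onCone f.1 ∘ γ) 0
             map_add' := fun f g => ?_
             map_smul' := fun c f => ?_ }, fun f g => ?_⟩, fun f hf => ?_⟩
  · rw [← deriv_add (hd f) (hd g), ← Pi.add_comp, ← onCone_add]
    rfl
  · rw [RingHom.id_apply, ← deriv_const_smul c (hd f), ← Pi.smul_comp, ← onCone_smul]
    rfl
  · simp only [LinearMap.coe_mk, AddHom.coe_mk]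
    change deriv (onCone (f.1 * g.1) ∘ γ) 0 = _
    rw [onCone_mul, Pi.mul_comp, deriv_mul (hd f) (hd g), Function.comp_apply,
      Function.comp_apply, h0, h0]
    ring
  · rw [dFun_apply hf]
    exact (hd ⟨f, hf⟩).hasDerivAt

end Curve

/-- The line through `p` with direction `η` in the chart `x_k ≠ 0`. -/
def chartLine (k : Fin (n + 1)) (p : S) (η : Fin n → ℂ) (t : ℂ) : Fin (n + 1) → ℂ :=
  p.1.x.rep + t • p.1.x.rep k • k.insertNth 0 η

theorem exists_tangent_of_chartLine {k : Fin (n + 1)} (hk : p.1.x.rep k ≠ 0) {a : ℂ → Fin m → ℂ}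
    {α : Fin m → ℂ} (ha : HasDerivAt a α 0) (hap : a 0 = p.1.a) {η : Fin n → ℂ}
    (hS : ∀ᶠ t in 𝓝 0, (a t, chartLine k p η t) ∈ cone S) :
    ∃ D : tangentSpace S p, dA p D = α ∧ dChart k p D = η ∧ ∀ f, IsRegularAt S p f →
      HasDerivAt (fun t => onCone f (a t, chartLine k p η t)) (dFun f p D) 0 := by
  have hγ : DifferentiableAt ℂ (fun t => (a t, chartLine k p η t)) 0 :=
    ha.differentiableAt.prodMk (by unfold chartLine; fun_prop)
  obtain ⟨D, hD⟩ := exists_tangent_of_curve (p := p) hγ (by simp [hap, chartLine, coneLift]) hS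
  refine ⟨D, funext fun i => ?_, funext fun j => ?_, hD⟩
  · refine (hD _ (isRegularAt_affineCoord p i)).unique
      ((hasDerivAt_pi.1 ha i).congr_of_eventuallyEq ?_)
    exact hS.mono fun t ht => onCone_affineCoord ht i
  · have hline : HasDerivAt (fun t => chartCoord S k j p + t * η j) (η j) 0 := by
      simpa using ((hasDerivAt_id (0 : ℂ)).mul_const (η j)).const_add (chartCoord S k j p)
    refine (hD _ (isRegularAt_chartCoord hk j)).unique (hline.congr_of_eventuallyEq ?_)
    filter_upwards [hS] with t ht
    rw [Function.comp_apply, chartCoord, onCone_formRatio ht]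
    simp only [chartLine, formRatio, eval_varForm, Pi.add_apply, Pi.smul_apply, smul_eq_mul,
      Fin.insertNth_apply_same, Fin.insertNth_apply_succAbove, mul_zero, add_zero]
    field_simp

end Curves

/-! ### Tangent spaces of open subsets of `ℂ^m × ℙ^n` -/

section OpenSubsets

variable {m n : ℕ} {Z : Set (AffProj m n)} {p : Z} {k : Fin (n + 1)}

lemma isOpen_cone_univ : IsOpen (cone (Set.univ : Set (AffProj m n))) := by
  have hcone : cone (Set.univ : Set (AffProj m n)) = {z | z.2 ≠ 0} := by
    ext z
    simp [cone]
  rw [hcone]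
  exact isOpen_ne_fun continuous_snd continuous_const

lemma exists_tangent_of_isOpen_cone (hZ : IsOpen (cone Z)) (hk : p.1.x.rep k ≠ 0)
    (α : Fin m → ℂ) (η : Fin n → ℂ) :
    ∃ D : tangentSpace Z p, dA p D = α ∧ dChart k p D = η ∧
      (α = 0 → D ∈ relTangentSpace AffProj.a Z p) ∧
      (η = 0 → D ∈ relTangentSpace AffProj.x Z p) := by
  have ha : HasDerivAt (fun t : ℂ => p.1.a + t • α) α 0 := by
    simpa using ((hasDerivAt_id (0 : ℂ)).smul_const α).const_add p.1.a
  have hS : ∀ᶠ t : ℂ in 𝓝 0, (p.1.a + t • α, chartLine k p η t) ∈ cone Z := by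
    have hcont : Continuous fun t : ℂ => (p.1.a + t • α, chartLine k p η t) := by
      unfold chartLine
      fun_prop
    refine hcont.continuousAt.eventually_mem (hZ.mem_nhds ?_)
    simpa [chartLine, coneLift] using coneLift_mem p
  obtain ⟨D, hDα, hDη, hD⟩ := exists_tangent_of_chartLine hk ha (by simp) hS
  refine ⟨D, hDα, hDη, ?_, ?_⟩
  · rintro rfl f ⟨g, hg⟩
    rw [← dFun_apply f.2]
    refine (hD f.1 f.2).unique ((hasDerivAt_const 0 (g p.1.a)).congr_of_eventuallyEq ?_)
    filter_upwards [hS] with t ht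
    rw [onCone_of_mem ht, hg]
    simp [coneMk]
  · rintro rfl f ⟨g, hg⟩
    rw [← dFun_apply f.2]
    refine (hD f.1 f.2).unique ((hasDerivAt_const 0 (g p.1.x)).congr_of_eventuallyEq ?_)
    filter_upwards [hS] with t ht
    rw [onCone_of_mem ht, hg]
    have h0 : (k.insertNth 0 0 : Fin (n + 1) → ℂ) = 0 :=
      funext (Fin.succAboveCases k (by simp) fun j => by simp)
    simp [coneMk, chartLine, h0]

lemma relTangentSpace_a_eq_ker (hZ : IsOpen (cone Z)) (p : Z) :
    relTangentSpace AffProj.a Z p = LinearMap.ker (dA p) := by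
  ext D
  refine ⟨fun hD => funext fun i => ?_, fun hD => ?_⟩
  · exact (dFun_apply (isRegularAt_affineCoord p i) D).trans (hD _ ⟨fun a => a i, fun _ => rfl⟩)
  · obtain ⟨k, hk⟩ := exists_rep_ne p.1.x
    obtain ⟨E, hEα, hEη, hE, -⟩ := exists_tangent_of_isOpen_cone hZ hk 0 (dChart k p D)
    rw [tangent_ext hk (LinearMap.mem_ker.1 hD |>.trans hEα.symm) hEη.symm]
    exact hE rfl

lemma dA_eq_zero (hZ : IsOpen (cone Z)) (D : relTangentSpace AffProj.a Z p) : dA p D.1 = 0 :=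
  LinearMap.mem_ker.1 ((relTangentSpace_a_eq_ker hZ p).le D.2)

lemma dFun_formRatio_eq_zero {D : tangentSpace Z p} (hD : D ∈ relTangentSpace AffProj.x Z p)
    {d : ℕ} (f : Form n d) {Q : Form n d} (hQ : eval p.1.x.rep Q.1 ≠ 0) :
    dFun (formRatio Z f Q) p D = 0 :=
  (dFun_apply (isRegularAt_formRatio f hQ) D).trans
    (hD _ ⟨fun x => eval x.rep f.1 / eval x.rep Q.1, fun _ => rfl⟩)

lemma relTangentSpace_x_eq_ker (hZ : IsOpen (cone Z)) (hk : p.1.x.rep k ≠ 0) :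
    relTangentSpace AffProj.x Z p = LinearMap.ker (dChart k p) := by
  ext D
  refine ⟨fun hD => funext fun j => dFun_formRatio_eq_zero hD _ (by simpa using hk),
    fun hD => ?_⟩
  obtain ⟨E, hEα, hEη, -, hE⟩ := exists_tangent_of_isOpen_cone hZ hk (dA p D) 0
  rw [tangent_ext hk hEα.symm (LinearMap.mem_ker.1 hD |>.trans hEη.symm)]
  exact hE rfl

lemma isCompl_relTangentSpace (hZ : IsOpen (cone Z)) (p : Z) :
    IsCompl (relTangentSpace AffProj.a Z p) (relTangentSpace AffProj.x Z p) := by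
  obtain ⟨k, hk⟩ := exists_rep_ne p.1.x
  rw [relTangentSpace_a_eq_ker hZ, relTangentSpace_x_eq_ker hZ hk]
  refine ⟨Submodule.disjoint_def.2 fun D ha hx => ?_,
    codisjoint_iff.2 (Submodule.eq_top_iff'.2 fun D => ?_)⟩
  · exact tangent_ext hk (ha.trans (map_zero _).symm) (hx.trans (map_zero _).symm)
  · obtain ⟨E, hEα, hEη, -⟩ := exists_tangent_of_isOpen_cone hZ hk 0 (dChart k p D)
    refine Submodule.mem_sup.2 ⟨E, hEα, D - E, ?_, add_sub_cancel E D⟩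
    rw [LinearMap.mem_ker, map_sub, hEη, sub_self]

/-- The coordinates along `ℙ^n` of the tangent vectors in that direction, in the chart
`x_k ≠ 0`. -/
def chartEquiv (hZ : IsOpen (cone Z)) (hk : p.1.x.rep k ≠ 0) :
    relTangentSpace AffProj.a Z p ≃ₗ[ℂ] Fin n → ℂ :=
  LinearEquiv.ofBijective ((dChart k p).domRestrict (relTangentSpace AffProj.a Z p)) <| by
    refine ⟨fun D E hDE => Subtype.ext (tangent_ext hk ?_ hDE), fun η => ?_⟩
    · rw [dA_eq_zero hZ, dA_eq_zero hZ]
    · obtain ⟨D, -, hDη, hD, -⟩ := exists_tangent_of_isOpen_cone hZ hk 0 η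
      exact ⟨⟨D, hD rfl⟩, hDη⟩

lemma chartEquiv_apply (hZ : IsOpen (cone Z)) (hk : p.1.x.rep k ≠ 0)
    (D : relTangentSpace AffProj.a Z p) : chartEquiv hZ hk D = dChart k p D.1 := rfl

open Classical in
/-- The coordinate vector fields of the chart `x_k ≠ 0` along `ℙ^n`, extended by `0`. -/
def chartField (hZ : IsOpen (cone Z)) (k : Fin (n + 1)) (j : Fin n) (q : Z) :
    relTangentSpace AffProj.a Z q :=
  if hk : q.1.x.rep k ≠ 0 then (chartEquiv hZ hk).symm (Pi.single j 1) else 0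

lemma chartField_eq (hZ : IsOpen (cone Z)) (hk : p.1.x.rep k ≠ 0) (j : Fin n) :
    chartField hZ k j p = (chartEquiv hZ hk).symm (Pi.single j 1) := dif_pos hk

lemma dChart_chartField (hZ : IsOpen (cone Z)) (hk : p.1.x.rep k ≠ 0) (j : Fin n) :
    dChart k p (chartField hZ k j p).1 = Pi.single j 1 := by
  rw [← chartEquiv_apply hZ hk, chartField_eq hZ hk, LinearEquiv.apply_symm_apply]

lemma isRegAt_chartField (hZ : IsOpen (cone Z)) (hk : p.1.x.rep k ≠ 0) (j : Fin n) :
    (relTangentBundle AffProj.a Z).IsRegAt p (chartField hZ k j) := by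
  refine isRegAt_of_dA_of_dChart hk (fun i => ?_) fun l => ?_
  · refine (isRegularAt_const p 0).congr (Eventually.of_forall fun q => ?_)
    exact (congrFun (dA_eq_zero hZ (chartField hZ k j q)) i).symm
  · refine (isRegularAt_const p ((Pi.single j 1 : Fin n → ℂ) l)).congr ?_
    filter_upwards [eventually_rep_ne hk] with q hq
    rw [dChart_chartField hZ hq]

lemma sum_dChart_smul_chartField (hZ : IsOpen (cone Z)) (hk : p.1.x.rep k ≠ 0)
    (D : relTangentSpace AffProj.a Z p) : ∑ j, dChart k p D.1 j • chartField hZ k j p = D := by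
  apply (chartEquiv hZ hk).injective
  simp only [map_sum, map_smul, chartField_eq hZ hk, LinearEquiv.apply_symm_apply]
  exact (pi_eq_sum_univ' _).symm

variable {S : Set (AffProj m n)} {p : S}

lemma dFun_formRatio (hk : p.1.x.rep k ≠ 0) {d : ℕ} (f : Form n d) {Q : Form n d}
    (hQ : eval p.1.x.rep Q.1 ≠ 0) (D : tangentSpace S p) :
    dFun (formRatio S f Q) p D = ∑ j, dChart k p D j *
      dFun (formRatio Set.univ f Q) (Set.inclusion S.subset_univ p)
        (chartField isOpen_cone_univ k j (Set.inclusion S.subset_univ p)).1 := by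
  set q := Set.inclusion S.subset_univ p
  have hkq : q.1.x.rep k ≠ 0 := hk
  set E : tangentSpace Set.univ q :=
    ∑ j, dChart k p D j • (chartField isOpen_cone_univ k j q).1
  have hE : dIncl S.subset_univ p D - E ∈ relTangentSpace AffProj.x Set.univ q := by
    rw [relTangentSpace_x_eq_ker isOpen_cone_univ hkq, LinearMap.mem_ker, map_sub,
      dChart_dIncl S.subset_univ hk, sub_eq_zero]
    simp only [E, map_sum, map_smul, dChart_chartField isOpen_cone_univ hkq]
    exact pi_eq_sum_univ' _
  have h := dFun_formRatio_eq_zero hE f (Q := Q) hQ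
  rw [map_sub, dFun_dIncl S.subset_univ (isRegularAt_formRatio f hQ), sub_eq_zero] at h
  refine h.trans ?_
  simp only [E, map_sum, map_smul, smul_eq_mul]

lemma isRegularAt_dFun_formRatio (hk : p.1.x.rep k ≠ 0) {d : ℕ} (f : Form n d) {Q : Form n d}
    (hQ : eval p.1.x.rep Q.1 ≠ 0) {s : ∀ q, tangentSpace S q}
    (hs : ∀ j, IsRegularAt S p fun q => dChart k q (s q) j) :
    IsRegularAt S p fun q => dFun (formRatio S f Q) q (s q) := by
  have hreg (j : Fin n) := (hs j).mul ((isRegularAt_dFun (isRegAt_chartField isOpen_cone_univ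
    (p := Set.inclusion S.subset_univ p) hk j)
    (isRegularAt_formRatio f hQ)).comp_inclusion S.subset_univ)
  refine (IsRegularAt.sum (s := Finset.univ) fun j _ => hreg j).congr ?_
  filter_upwards [eventually_rep_ne hk, eventually_eval_rep_ne hQ] with q hkq hQq
  rw [dFun_formRatio hkq f hQq, Finset.sum_apply]
  rfl

end OpenSubsets

/-! ### Twists -/

section Line

variable {n k : ℕ} {x : ℙ ℂ (Fin (n + 1) → ℂ)}

/-- The representative of a point, as a vector of the corresponding line. -/
def repVec (x : ℙ ℂ (Fin (n + 1) → ℂ)) : x.submodule :=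
  ⟨x.rep, by rw [Projectivization.submodule_eq]; exact Submodule.mem_span_singleton_self _⟩

lemma lineFun_ext {s t : lineFun k x} (hst : s.1 (repVec x) = t.1 (repVec x)) : s = t := by
  ext w
  have hw : w.1 ∈ Submodule.span ℂ {x.rep} := by
    rw [← Projectivization.submodule_eq]
    exact w.2
  obtain ⟨c, hc⟩ := Submodule.mem_span_singleton.1 hw
  have hwc : w = c • repVec x := Subtype.ext hc.symm
  rw [hwc, s.2, t.2, hst]

lemma div_smul_lineFun {ζ : lineFun k x} (hζ : ζ.1 (repVec x) ≠ 0) (s : lineFun k x) :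
    (s.1 (repVec x) / ζ.1 (repVec x)) • ζ = s :=
  lineFun_ext (div_mul_cancel₀ _ hζ)

/-- The trivialization of a fibre of `O(k)` by a nonzero element. -/
def lineFunEquiv (ζ : lineFun k x) (hζ : ζ.1 (repVec x) ≠ 0) : ℂ ≃ₗ[ℂ] lineFun k x :=
  LinearEquiv.ofBijective (LinearMap.toSpanSingleton ℂ _ ζ)
    ⟨fun _ _ hcd => mul_right_cancel₀ hζ (congrArg (fun s => s.1 (repVec x)) hcd),
      fun s => ⟨_, div_smul_lineFun hζ s⟩⟩

/-- The trivialization `v ↦ v ⊗ ζ` of a twist by a generator `ζ` of the fibre of `O(1)`. -/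
def twistEquiv (V : Type*) [AddCommGroup V] [Module ℂ V] (ζ : lineFun 1 x)
    (hζ : ζ.1 (repVec x) ≠ 0) : V ≃ₗ[ℂ] V ⊗[ℂ] lineFun 1 x :=
  (TensorProduct.rid ℂ V).symm ≪≫ₗ LinearEquiv.lTensor V (lineFunEquiv ζ hζ)

variable {V : Type*} [AddCommGroup V] [Module ℂ V] {ζ : lineFun 1 x}

@[simp] lemma twistEquiv_apply (hζ : ζ.1 (repVec x) ≠ 0) (v : V) :
    twistEquiv V ζ hζ v = v ⊗ₜ ζ := congrArg (v ⊗ₜ[ℂ] ·) (one_smul ℂ ζ)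

lemma exists_eq_tmul (hζ : ζ.1 (repVec x) ≠ 0) (τ : V ⊗[ℂ] lineFun 1 x) :
    ∃ v : V, τ = v ⊗ₜ ζ := by
  obtain ⟨v, rfl⟩ := (twistEquiv V ζ hζ).surjective τ
  exact ⟨v, twistEquiv_apply hζ v⟩

lemma formAt_varForm_ne {j : Fin (n + 1)} (hj : x.rep j ≠ 0) :
    (formAt (varForm j) x).1 (repVec x) ≠ 0 := (eval_varForm j x.rep).trans_ne hj

/-- The generator of the fibre of `O(1)` with value `1` at the representative of the point. -/
def repDual (x : ℙ ℂ (Fin (n + 1) → ℂ)) : lineFun 1 x :=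
  (x.rep (exists_rep_ne x).choose)⁻¹ • formAt (varForm (exists_rep_ne x).choose) x

lemma repDual_repVec (x : ℙ ℂ (Fin (n + 1) → ℂ)) : (repDual x).1 (repVec x) = 1 := by
  change (x.rep _)⁻¹ * eval x.rep (varForm _).1 = 1
  rw [eval_varForm, inv_mul_cancel₀ (exists_rep_ne x).choose_spec]

lemma repDual_repVec_ne (x : ℙ ℂ (Fin (n + 1) → ℂ)) : (repDual x).1 (repVec x) ≠ 0 :=
  repDual_repVec x ▸ one_ne_zero

lemma formAt_eq_smul_repDual (f : Form n 1) (x : ℙ ℂ (Fin (n + 1) → ℂ)) :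
    formAt f x = eval x.rep f.1 • repDual x :=
  lineFun_ext ((mul_one _).symm.trans (congrArg (_ * ·) (repDual_repVec x).symm))

end Line

section Twists

variable {m n : ℕ} {S : Set (AffProj m n)} {p : S} {k : Fin (n + 1)}

/-- The regular sections form a sheaf of modules over the regular functions. -/
structure RegBundle.HasRegularModule (E : RegBundle S) : Prop where
  congr {p : S} {s t : ∀ q, E.fibre q} : E.IsRegAt p s → (∀ᶠ q in 𝓝 p, s q = t q) → E.IsRegAt p t
  sum {p : S} {r : ℕ} {g : Fin r → S → ℂ} {s : Fin r → ∀ q, E.fibre q} :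
    (∀ i, IsRegularAt S p (g i)) → (∀ i, E.IsRegAt p (s i)) →
      E.IsRegAt p fun q => ∑ i, g i q • s i q

lemma tangentBundle_hasRegularModule (S : Set (AffProj m n)) :
    (tangentBundle S).HasRegularModule where
  congr {p s t} hs hst f hf := by
    refine (hs f hf).congr (hst.mono fun q hq => ?_)
    exact congrArg (dFun f q) hq
  sum {p r g s} hg hs f hf := by
    refine (IsRegularAt.sum (s := Finset.univ) fun i _ => (hg i).mul (hs i f hf)).congr
      (Eventually.of_forall fun q => ?_)
    rw [Finset.sum_apply]
    refine Eq.trans ?_ (map_sum (dFun f q) (fun i => g i q • s i q) Finset.univ).symm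
    exact Finset.sum_congr rfl fun i _ => ((dFun f q).map_smul (g i q) (s i q)).symm

lemma RegBundle.HasRegularModule.sub {E : RegBundle S} (hE : E.HasRegularModule)
    (G : ∀ p, Submodule ℂ (E.fibre p)) : (E.sub G).HasRegularModule where
  congr hs hst := hE.congr hs (hst.mono fun _ hq => congrArg Subtype.val hq)
  sum {_ _ g s} hg hs := hE.congr (hE.sum hg hs) (Eventually.of_forall fun q =>
    (map_sum (G q).subtype (fun i => g i q • (s i q : G q)) Finset.univ).symm)

lemma isRegAt_formAt (f : Form n 1) (p : S) :
    (lineBundle 1 S).IsRegAt p fun q => formAt f q.1.x := by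
  refine ⟨0, map C f.1, 1, ((mem_homogeneousSubmodule 1 f.1).1 f.2).map _, isHomogeneous_one _ _,
    by simp [evp, ev], Eventually.of_forall fun q w => ?_⟩
  have hcomp : (eval q.1.a).comp (C : ℂ →+* MvPolynomial (Fin m) ℂ) = RingHom.id ℂ := by
    ext r; simp
  simp [ev, formAt, MvPolynomial.map_map, hcomp]

lemma isRegularAt_of_isRegAt_lineBundle {t : ∀ q, (lineBundle 1 S).fibre q}
    (ht : (lineBundle 1 S).IsRegAt p t) (hk : p.1.x.rep k ≠ 0) :
    IsRegularAt S p fun q => (t q).1 (repVec q.1.x) / q.1.x.rep k := by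
  obtain ⟨d, P, Q, hP, hQ, hQp, ht⟩ := ht
  have hX (q : AffProj m n) : evp (X k : BiPoly m n) q = q.x.rep k := by simp [evp, ev]
  refine ⟨d + 1, P, Q * X k, hP, hQ.mul (isHomogeneous_X _ _), ?_, ?_⟩
  · rw [evp_mul, hX]
    exact mul_ne_zero hQp hk
  · filter_upwards [ht, eventually_evp_ne p hQ hQp] with q hq hQq
    rw [evp_mul, hX, ← div_div]
    exact congrArg (· / _) ((eq_div_iff hQq).2 (hq (repVec q.1.x)))

theorem twist_isRegAt_iff {E : RegBundle S} (hE : E.HasRegularModule) (hk : p.1.x.rep k ≠ 0)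
    (r : ∀ q, E.fibre q ⊗[ℂ] lineFun 1 q.1.x) :
    E.twist.IsRegAt p r ↔ ∃ s : ∀ q, E.fibre q, E.IsRegAt p s ∧
      ∀ᶠ q in 𝓝 p, r q = s q ⊗ₜ formAt (varForm k) q.1.x := by
  constructor
  · rintro ⟨N, s, t, hs, ht, hr⟩
    refine ⟨fun q => ∑ i, ((t i q).1 (repVec q.1.x) / q.1.x.rep k) • s i q,
      hE.sum (fun i => isRegularAt_of_isRegAt_lineBundle (ht i) hk) hs, ?_⟩
    filter_upwards [hr, eventually_rep_ne hk] with q hrq hkq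
    rw [hrq, TensorProduct.sum_tmul]
    refine Finset.sum_congr rfl fun i _ => ?_
    rw [TensorProduct.smul_tmul, ← eval_varForm k q.1.x.rep]
    exact congrArg (s i q ⊗ₜ[ℂ] ·) (div_smul_lineFun (formAt_varForm_ne hkq) (t i q)).symm
  · rintro ⟨s, hs, hr⟩
    refine ⟨1, fun _ => s, fun _ q => formAt (varForm k) q.1.x, fun _ => hs,
      fun _ => isRegAt_formAt _ p, hr.mono fun q hq => ?_⟩
    rw [hq, Finset.univ_unique, Finset.sum_singleton]
    rfl

end Twists

section RelativeTangentBundle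

variable {m n : ℕ} {S Z : Set (AffProj m n)} {p : S} {k : Fin (n + 1)} (hZ : IsOpen (cone Z))
  (h : S ⊆ Z)

/-- The frame of the twisted relative tangent bundle along `ℙ^n` given by the coordinate vector
fields of the chart `x_k ≠ 0`, multiplied by the generator `x_k` of `O(1)`. -/
def chartFrame (k : Fin (n + 1)) (j : Fin n) (q : S) :
    (((relTangentBundle AffProj.a Z).twist).restrict h).fibre q :=
  (chartField hZ k j (Set.inclusion h q) ⊗ₜ[ℂ] formAt (varForm k) q.1.x :
    relTangentSpace AffProj.a Z (Set.inclusion h q) ⊗[ℂ] lineFun 1 q.1.x)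

lemma sum_dChart_smul_chartFrame (hk : p.1.x.rep k ≠ 0)
    (D : relTangentSpace AffProj.a Z (Set.inclusion h p)) :
    ∑ j, dChart k (Set.inclusion h p) D.1 j • chartFrame hZ h k j p =
      (D ⊗ₜ[ℂ] formAt (varForm k) p.1.x :
        relTangentSpace AffProj.a Z (Set.inclusion h p) ⊗[ℂ] lineFun 1 p.1.x) := by
  conv_rhs => rw [← sum_dChart_smul_chartField hZ hk D, TensorProduct.sum_tmul]
  exact Finset.sum_congr rfl fun j _ => (TensorProduct.smul_tmul' _ _ _).symm

lemma exists_basis_chartFrame (hk : p.1.x.rep k ≠ 0) :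
    ∃ b : Module.Basis (Fin n) ℂ ((((relTangentBundle AffProj.a Z).twist).restrict h).fibre p),
      ∀ j, b j = chartFrame hZ h k j p := by
  let b : Module.Basis (Fin n) ℂ
      (relTangentSpace AffProj.a Z (Set.inclusion h p) ⊗[ℂ] lineFun 1 p.1.x) :=
    (Module.Basis.ofEquivFun (chartEquiv hZ (p := Set.inclusion h p) hk)).map
      (twistEquiv (relTangentSpace AffProj.a Z (Set.inclusion h p)) _ (formAt_varForm_ne hk))
  refine ⟨b, fun j => ?_⟩
  have hb : b j = chartField hZ k j (Set.inclusion h p) ⊗ₜ formAt (varForm k) p.1.x := by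
    rw [Module.Basis.map_apply, Module.Basis.coe_ofEquivFun, twistEquiv_apply,
      chartField_eq hZ (p := Set.inclusion h p) hk]
  exact hb

theorem restrict_twist_isRegAt_iff (hk : p.1.x.rep k ≠ 0)
    (r : ∀ q, (((relTangentBundle AffProj.a Z).twist).restrict h).fibre q) :
    (((relTangentBundle AffProj.a Z).twist).restrict h).IsRegAt p r ↔
      ∃ g : Fin n → S → ℂ, (∀ j, IsRegularAt S p (g j)) ∧
        ∀ᶠ q in 𝓝 p, r q = ∑ j, g j q • chartFrame hZ h k j q := by
  have hmod := (tangentBundle_hasRegularModule Z).sub (relTangentSpace AffProj.a Z)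
  have hkZ : (Set.inclusion h p).1.x.rep k ≠ 0 := hk
  constructor
  · rintro ⟨N, g, s, hg, hs, hr⟩
    choose D hD hsD using fun i => (twist_isRegAt_iff hmod hkZ (s i)).1 (hs i)
    refine ⟨fun j => ∑ i, g i * fun q => dChart k (Set.inclusion h q) (D i _).1 j,
      fun j => .sum fun i _ => (hg i).mul ((isRegularAt_dFun (hD i)
        (isRegularAt_chartCoord hkZ j)).comp_inclusion h), ?_⟩
    filter_upwards [hr, eventually_rep_ne hk, (continuous_inclusion h).continuousAt.eventually
      (eventually_all.2 hsD)] with q hrq hkq hsq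
    simp only [hrq, hsq, Finset.sum_apply, Pi.mul_apply, Finset.sum_smul, mul_smul]
    rw [Finset.sum_comm]
    refine Finset.sum_congr rfl fun i _ => ?_
    rw [← Finset.smul_sum]
    exact congrArg (g i q • ·) (sum_dChart_smul_chartFrame hZ h hkq _).symm
  · rintro ⟨g, hg, hr⟩
    refine ⟨n, g, fun j q => (chartField hZ k j q ⊗ₜ[ℂ] formAt (varForm k) q.1.x :
      relTangentSpace AffProj.a Z q ⊗[ℂ] lineFun 1 q.1.x), hg, fun j => ?_, hr⟩
    exact (twist_isRegAt_iff hmod hkZ _).2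
      ⟨chartField hZ k j, isRegAt_chartField hZ hkZ j, Eventually.of_forall fun _ => rfl⟩

include hZ in
theorem isLocallyFree_restrict_twist :
    (((relTangentBundle AffProj.a Z).twist).restrict h).IsLocallyFree n := by
  intro p
  obtain ⟨k, hk⟩ := exists_rep_ne p.1.x
  refine ⟨chartFrame hZ h k, ?_⟩
  filter_upwards [eventually_rep_ne hk] with q hq
  exact ⟨exists_basis_chartFrame hZ h hq, restrict_twist_isRegAt_iff hZ h hq⟩

end RelativeTangentBundle

/-! ### The coefficient vectors of the `u_i` -/

section LinearAlgebra

variable {K : Type*} [Field K] {h : ℕ}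

/-- The vector `c_0 e_0 - c_i e_i`, `i = 1, …, h`, of the coefficients of `u_i` when the `L_j` take
the values `c_j`. The index `i = 1, …, h` is `i.succ` with `i : Fin h`. -/
def uCoeff (c : Fin (h + 1) → K) (i : Fin h) : Fin (h + 1) → K :=
  c 0 • Pi.single 0 1 - c i.succ • Pi.single i.succ 1

lemma uCoeff_zero (c : Fin (h + 1) → K) (i : Fin h) : uCoeff c i 0 = c 0 := by
  simp [uCoeff]

lemma uCoeff_succ (c : Fin (h + 1) → K) (i j : Fin h) :
    uCoeff c i j.succ = if j = i then -c i.succ else 0 := by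
  rcases eq_or_ne j i with rfl | hji
  · simp [uCoeff]
  · simp [uCoeff, hji]

lemma exists_prod_erase_ne_zero {c : Fin (h + 1) → K} (hc : ∀ i j, i ≠ j → c i ≠ 0 ∨ c j ≠ 0) :
    ∃ i, ∏ j ∈ Finset.univ.erase i, c j ≠ 0 := by
  simp only [Finset.prod_ne_zero_iff, Finset.mem_erase, Finset.mem_univ, and_true]
  by_cases hall : ∀ i, c i ≠ 0
  · exact ⟨0, fun j _ => hall j⟩
  · push Not at hall
    obtain ⟨i, hi⟩ := hall
    exact ⟨i, fun j hj => (hc j i hj).resolve_right (not_not.2 hi)⟩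

lemma linearIndependent_uCoeff {c : Fin (h + 1) → K} (hc : ∀ i j, i ≠ j → c i ≠ 0 ∨ c j ≠ 0) :
    LinearIndependent K (uCoeff c) := by
  rw [Fintype.linearIndependent_iff]
  intro g hg
  have hsucc (i : Fin h) : g i * c i.succ = 0 := by
    simpa [uCoeff_succ] using congrFun hg i.succ
  have hzero : (∑ i, g i) * c 0 = 0 := by
    simpa [uCoeff_zero, Finset.sum_mul] using congrFun hg 0
  intro i
  by_contra hgi
  have hci : c i.succ = 0 := (mul_eq_zero.1 (hsucc i)).resolve_left hgi
  have hne {j : Fin (h + 1)} (hj : j ≠ i.succ) : c j ≠ 0 :=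
    (hc j i.succ hj).resolve_right (not_not.2 hci)
  have hg0 (j : Fin h) (hj : j ≠ i) : g j = 0 :=
    (mul_eq_zero.1 (hsucc j)).resolve_right (hne (Fin.succ_injective h |>.ne hj))
  rw [Fintype.sum_eq_single i hg0] at hzero
  exact mul_ne_zero hgi (hne (Fin.succ_ne_zero i).symm) hzero

lemma sum_prod_erase_mul_uCoeff (c : Fin (h + 1) → K) (i : Fin h) :
    ∑ l, (∏ j ∈ Finset.univ.erase l, c j) * uCoeff c i l = 0 := by
  have hprod (l : Fin (h + 1)) : (∏ j ∈ Finset.univ.erase l, c j) * c l = ∏ j, c j :=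
    Finset.prod_erase_mul _ _ (Finset.mem_univ l)
  simp [uCoeff, mul_sub, Pi.single_apply, Finset.sum_sub_distrib, hprod]

theorem mem_span_uCoeff_iff {c : Fin (h + 1) → K} (hc : ∀ i j, i ≠ j → c i ≠ 0 ∨ c j ≠ 0)
    {α : Fin (h + 1) → K} : α ∈ Submodule.span K (Set.range (uCoeff c)) ↔
      ∑ l, (∏ j ∈ Finset.univ.erase l, c j) * α l = 0 := by
  let φ : (Fin (h + 1) → K) →ₗ[K] K := ∑ l, (∏ j ∈ Finset.univ.erase l, c j) • LinearMap.proj l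
  have hφ (β) : φ β = ∑ l, (∏ j ∈ Finset.univ.erase l, c j) * β l := by simp [φ]
  have hle : Submodule.span K (Set.range (uCoeff c)) ≤ LinearMap.ker φ :=
    Submodule.span_le.2 <| Set.range_subset_iff.2 fun i =>
      (hφ _).trans (sum_prod_erase_mul_uCoeff c i)
  have hφ0 : φ ≠ 0 := by
    obtain ⟨i, hi⟩ := exists_prod_erase_ne_zero hc
    rintro h0
    exact hi (by simpa [h0, Pi.single_apply] using (hφ (Pi.single i 1)).symm)
  have hker : Module.finrank K (LinearMap.ker φ) = h := by
    have := Module.Dual.finrank_ker_add_one_of_ne_zero (f := φ) hφ0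
    rwa [Module.finrank_fin_fun, add_left_inj] at this
  have hspan : Submodule.span K (Set.range (uCoeff c)) = LinearMap.ker φ :=
    Submodule.eq_of_le_of_finrank_eq hle <| by
      rw [hker, finrank_span_eq_card (linearIndependent_uCoeff hc), Fintype.card_fin]
  rw [hspan, LinearMap.mem_ker, hφ]

end LinearAlgebra

/-! ### The family of hypersurfaces -/

section OpenParameters

variable {n h : ℕ} {f₀ : Form n h} {L : Fin (h + 1) → Form n 1}

lemma isSmoothForm_iff_forall_mem_sphere {d : ℕ} (f : Form n d) :
    IsSmoothForm f.1 ↔ ∀ w ∈ Metric.sphere (0 : Fin (n + 1) → ℂ) 1,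
      eval w f.1 ≠ 0 ∨ ∃ j, eval w (pderiv j f.1) ≠ 0 := by
  refine ⟨fun hf w hw => or_iff_not_imp_left.2 fun hfw =>
    hf w (ne_zero_of_mem_unit_sphere ⟨w, hw⟩) (not_not.1 hfw), fun hf w hw hfw => ?_⟩
  have hdf (j : Fin (n + 1)) : (pderiv j f.1).IsHomogeneous (d - 1) :=
    ((mem_homogeneousSubmodule d f.1).1 f.2).pderiv
  have hsphere : (‖w‖ : ℂ)⁻¹ • w ∈ Metric.sphere (0 : Fin (n + 1) → ℂ) 1 := by
    simp [norm_smul, hw]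
  rcases hf _ hsphere with hne | ⟨j, hj⟩
  · rw [eval_smul_form, hfw, mul_zero] at hne
    exact absurd rfl hne
  · refine ⟨j, right_ne_zero_of_mul (a := (‖w‖ : ℂ)⁻¹ ^ (d - 1)) ?_⟩
    rwa [← eval_smul_form ⟨_, (mem_homogeneousSubmodule _ _).2 (hdf j)⟩]

lemma eval_member (a : Fin (h + 1) → ℂ) (w : Fin (n + 1) → ℂ) :
    eval w (member f₀ L a).1 = eval w f₀.1 + ∑ i, a i * eval w (omitProd L i).1 := by
  simp [member]

lemma eval_pderiv_member (a : Fin (h + 1) → ℂ) (w : Fin (n + 1) → ℂ) (j : Fin (n + 1)) :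
    eval w (pderiv j (member f₀ L a).1) =
      eval w (pderiv j f₀.1) + ∑ i, a i * eval w (pderiv j (omitProd L i).1) := by
  simp [member]

lemma isOpen_parA (f₀ : Form n h) (L : Fin (h + 1) → Form n 1) : IsOpen (parA f₀ L) := by
  have hcont (g : MvPolynomial (Fin (n + 1)) ℂ) (G : Fin (h + 1) → MvPolynomial (Fin (n + 1)) ℂ) :
      Continuous fun z : (Fin (h + 1) → ℂ) × (Fin (n + 1) → ℂ) =>
        eval z.2 g + ∑ i, z.1 i * eval z.2 (G i) :=
    (g.continuous_eval.comp continuous_snd).add <| continuous_finsetSum _ fun i _ =>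
      ((continuous_apply i).comp continuous_fst).mul ((G i).continuous_eval.comp continuous_snd)
  simp only [parA, isSmoothForm_iff_forall_mem_sphere, eval_member, eval_pderiv_member]
  refine isOpen_iff_eventually.2 fun a ha =>
    (isCompact_sphere _ _).eventually_forall_of_forall_eventually fun w hw => ?_
  rcases ha w hw with hne | ⟨j, hj⟩
  · exact ((hcont _ _).continuousAt.eventually_ne (x := (a, w)) hne).mono fun _ => Or.inl
  · exact ((hcont _ _).continuousAt.eventually_ne (x := (a, w)) hj).mono fun _ h => .inr ⟨j, h⟩

lemma isOpen_cone_prodAW (f₀ : Form n h) (L : Fin (h + 1) → Form n 1) :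
    IsOpen (cone (prodAW f₀ L)) := by
  have hcone : cone (prodAW f₀ L) = {z | z.2 ≠ 0 ∧ z.1 ∈ parA f₀ L ∧
      ∀ i j, i < j → eval z.2 (L i).1 ≠ 0 ∨ eval z.2 (L j).1 ≠ 0} := by
    ext z
    simp only [cone, prodAW, openW, projZeros, Set.mem_ofPred_eq, exists_prop,
      eval_rep_mk_eq_zero_iff, not_and_or]
  have hL (i : Fin (h + 1)) :
      IsOpen {z : (Fin (h + 1) → ℂ) × (Fin (n + 1) → ℂ) | eval z.2 (L i).1 ≠ 0} :=
    isOpen_ne_fun ((L i).1.continuous_eval.comp continuous_snd) continuous_const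
  simp only [hcone, Set.ofPred_and, Set.ofPred_forall, Set.ofPred_or]
  exact (isOpen_ne_fun continuous_snd continuous_const).inter <|
    ((isOpen_parA f₀ L).preimage continuous_fst).inter <|
      isOpen_iInter_of_finite fun i => isOpen_iInter_of_finite fun j =>
        isOpen_iInter_of_finite fun _ => (hL i).union (hL j)

lemma mem_cone_XW_iff {z : (Fin (h + 1) → ℂ) × (Fin (n + 1) → ℂ)} :
    z ∈ cone (XW f₀ L) ↔ z ∈ cone (prodAW f₀ L) ∧ eval z.2 (member f₀ L z.1).1 = 0 :=
  ⟨fun ⟨hz, hmem, hzero⟩ => ⟨⟨hz, hmem⟩, (eval_rep_mk_eq_zero_iff _ hz).1 hzero⟩,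
    fun ⟨⟨hz, hmem⟩, hzero⟩ => ⟨hz, hmem, (eval_rep_mk_eq_zero_iff _ hz).2 hzero⟩⟩

lemma eval_omitProd (i : Fin (h + 1)) (w : Fin (n + 1) → ℂ) :
    eval w (omitProd L i).1 = ∏ j ∈ Finset.univ.erase i, eval w (L j).1 := by
  simp [omitProd]

lemma eval_ne_or_eval_ne {x : ℙ ℂ (Fin (n + 1) → ℂ)} (hx : x ∈ openW L) (i j : Fin (h + 1))
    (hij : i ≠ j) : eval x.rep (L i).1 ≠ 0 ∨ eval x.rep (L j).1 ≠ 0 := by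
  rcases lt_or_gt_of_ne hij with hlt | hgt
  · exact not_and_or.1 (hx i j hlt)
  · exact (not_and_or.1 (hx j i hgt)).symm

lemma exists_eval_omitProd_ne {x : ℙ ℂ (Fin (n + 1) → ℂ)} (hx : x ∈ openW L) :
    ∃ i, eval x.rep (omitProd L i).1 ≠ 0 := by
  simpa only [eval_omitProd] using exists_prod_erase_ne_zero (eval_ne_or_eval_ne hx)

end OpenParameters

section TangentSpaceXW

variable {n h : ℕ} {f₀ : Form n h} {L : Fin (h + 1) → Form n 1} {p : XW f₀ L} {k : Fin (n + 1)}

lemma dFun_equation (D : tangentSpace (XW f₀ L) p) {Q : Form n h}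
    (hQ : eval p.1.x.rep Q.1 ≠ 0) :
    dFun (formRatio _ f₀ Q) p D + ∑ l, (p.1.a l * dFun (formRatio _ (omitProd L l) Q) p D +
      eval p.1.x.rep (omitProd L l).1 / eval p.1.x.rep Q.1 * dA p D l) = 0 := by
  have hzero : formRatio (XW f₀ L) f₀ Q +
      ∑ l, affineCoord _ l * formRatio _ (omitProd L l) Q = fun _ => 0 := by
    ext q
    have hq : eval q.1.x.rep (member f₀ L q.1.a).1 = 0 := q.2.2
    rw [eval_member] at hq
    simp only [Pi.add_apply, Finset.sum_apply, Pi.mul_apply, formRatio, affineCoord,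
      ← mul_div_assoc]
    rw [← Finset.sum_div, ← add_div, hq, zero_div]
  have hreg (l : Fin (h + 1)) := isRegularAt_affineCoord p l
  have hreg' (l : Fin (h + 1)) := isRegularAt_formRatio (p := p) (omitProd L l) hQ
  have hd := congrArg (fun f => dFun f p D) hzero
  simp only [dFun_const, dFun_add (isRegularAt_formRatio f₀ hQ)
    (IsRegularAt.sum fun l _ => (hreg l).mul (hreg' l)),
    dFun_sum fun l _ => (hreg l).mul (hreg' l), dFun_mul (hreg _) (hreg' _)] at hd
  simp only [LinearMap.add_apply, LinearMap.sum_apply, LinearMap.smul_apply, smul_eq_mul,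
    LinearMap.zero_apply] at hd
  exact hd

lemma sum_eval_omitProd_mul_dA_eq_zero (hk : p.1.x.rep k ≠ 0) {D : tangentSpace (XW f₀ L) p}
    (hD : dChart k p D = 0) : ∑ l, eval p.1.x.rep (omitProd L l).1 * dA p D l = 0 := by
  obtain ⟨i, hi⟩ := exists_eval_omitProd_ne p.2.1.2
  have hf (f : Form n h) : dFun (formRatio (XW f₀ L) f (omitProd L i)) p D = 0 := by
    rw [dFun_formRatio hk f hi, hD]
    simp
  have hsum := dFun_equation D hi
  simp only [hf, mul_zero, zero_add, div_mul_eq_mul_div] at hsum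
  rwa [← Finset.sum_div, div_eq_zero_iff, or_iff_left hi] at hsum

lemma eval_member_sub_single (a : Fin (h + 1) → ℂ) (b : ℂ) (i : Fin (h + 1))
    (w : Fin (n + 1) → ℂ) : eval w (member f₀ L (a - b • Pi.single i 1)).1 =
      eval w (member f₀ L a).1 - b * eval w (omitProd L i).1 := by
  simp [eval_member, sub_mul, Finset.sum_sub_distrib, Pi.single_apply, add_sub_assoc]

/-- Where `M_i ≠ 0`, the equation of `X_W` expresses `a_i` through the other coordinates. -/
theorem exists_tangent_XW (hk : p.1.x.rep k ≠ 0) {i : Fin (h + 1)}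
    (hi : eval p.1.x.rep (omitProd L i).1 ≠ 0) (α : Fin (h + 1) → ℂ) (η : Fin n → ℂ) :
    ∃ D : tangentSpace (XW f₀ L) p, (∀ l ≠ i, dA p D l = α l) ∧ dChart k p D = η := by
  let w := chartLine k p η
  let b : ℂ → ℂ := fun t =>
    eval (w t) (member f₀ L (p.1.a + t • α)).1 / eval (w t) (omitProd L i).1
  let a : ℂ → Fin (h + 1) → ℂ := fun t => p.1.a + t • α - b t • Pi.single i 1
  have hw0 : w 0 = p.1.x.rep := by simp [w, chartLine]
  have hw : DifferentiableAt ℂ w 0 := by unfold w chartLine; fun_prop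
  have heval (f : MvPolynomial (Fin (n + 1)) ℂ) : DifferentiableAt ℂ (fun t => eval (w t) f) 0 :=
    (AnalyticOnNhd.eval_mvPolynomial f (w 0) trivial).differentiableAt.comp 0 hw
  have hb : DifferentiableAt ℂ b 0 := by
    refine DifferentiableAt.div ?_ (heval _) (by rwa [hw0])
    simp only [eval_member]
    refine (heval _).fun_add (.fun_sum fun l _ => .mul ?_ (heval _))
    simp only [Pi.add_apply, Pi.smul_apply]
    fun_prop
  have hb0 : b 0 = 0 := by
    have hp : eval p.1.x.rep (member f₀ L p.1.a).1 = 0 := p.2.2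
    simp [b, hw0, hp]
  have ha : HasDerivAt a (α - deriv b 0 • Pi.single i 1) 0 := by
    have hα := ((hasDerivAt_id (0 : ℂ)).smul_const α).const_add p.1.a
    simpa using hα.fun_sub (hb.hasDerivAt.smul_const (Pi.single i (1 : ℂ)))
  have ha0 : a 0 = p.1.a := by simp [a, hb0]
  have hcone : ∀ᶠ t in 𝓝 0, (a t, w t) ∈ cone (prodAW f₀ L) := by
    refine (ha.continuousAt.prodMk hw.continuousAt).eventually_mem
      ((isOpen_cone_prodAW f₀ L).mem_nhds ?_)
    rw [ha0, hw0]
    exact coneLift_mem (Set.inclusion (XW_subset f₀ L) p)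
  obtain ⟨D, hDa, hDx, -⟩ := exists_tangent_of_chartLine hk ha ha0 (S := XW f₀ L) <| by
    filter_upwards [hcone, (heval _).continuousAt.eventually_ne (by rwa [hw0])] with t ht hit
    refine mem_cone_XW_iff.2 ⟨ht, (eval_member_sub_single _ _ _ _).trans (sub_eq_zero.2 ?_)⟩
    exact (div_mul_cancel₀ _ hit).symm
  exact ⟨D, fun l hl => by simp [hDa, hl], hDx⟩

theorem exists_vertical_tangent_XW (hk : p.1.x.rep k ≠ 0) {α : Fin (h + 1) → ℂ}
    (hα : ∑ l, eval p.1.x.rep (omitProd L l).1 * α l = 0) :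
    ∃ D : tangentSpace (XW f₀ L) p, dA p D = α ∧ dChart k p D = 0 := by
  obtain ⟨i, hi⟩ := exists_eval_omitProd_ne p.2.1.2
  obtain ⟨D, hDα, hDη⟩ := exists_tangent_XW hk hi α 0
  refine ⟨D, funext fun l => ?_, hDη⟩
  have hdiff : ∑ l, eval p.1.x.rep (omitProd L l).1 * (dA p D l - α l) = 0 := by
    simp only [mul_sub, Finset.sum_sub_distrib, hα, sum_eval_omitProd_mul_dA_eq_zero hk hDη,
      sub_zero]
  rw [Fintype.sum_eq_single i fun l hl => by rw [hDα l hl, sub_self, mul_zero]] at hdiff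
  rcases eq_or_ne l i with rfl | hl
  · exact sub_eq_zero.1 ((mul_eq_zero.1 hdiff).resolve_left hi)
  · exact hDα l hl

theorem isRegAt_of_dA_of_ne {i : Fin (h + 1)} (hk : p.1.x.rep k ≠ 0)
    (hi : eval p.1.x.rep (omitProd L i).1 ≠ 0) {s : ∀ q, tangentSpace (XW f₀ L) q}
    (ha : ∀ l ≠ i, IsRegularAt (XW f₀ L) p fun q => dA q (s q) l)
    (hx : ∀ j, IsRegularAt (XW f₀ L) p fun q => dChart k q (s q) j) :
    (tangentBundle (XW f₀ L)).IsRegAt p s := by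
  have hr (f : Form n h) : IsRegularAt (XW f₀ L) p fun q =>
      dFun (formRatio _ f (omitProd L i)) q (s q) := isRegularAt_dFun_formRatio hk f hi hx
  refine isRegAt_of_dA_of_dChart hk (fun l => ?_) hx
  rcases eq_or_ne l i with rfl | hl
  swap
  · exact ha l hl
  have hsum := ((hr f₀).add <| (IsRegularAt.sum (s := Finset.univ) fun l _ =>
    (isRegularAt_affineCoord p l).mul (hr (omitProd L l))).add <|
      IsRegularAt.sum (s := Finset.univ.erase l) fun l' hl' =>
        (isRegularAt_formRatio (omitProd L l') hi).mul (ha l' (Finset.ne_of_mem_erase hl'))).neg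
  refine hsum.congr ?_
  filter_upwards [eventually_eval_rep_ne hi] with q hq
  have heq := dFun_equation (s q) hq
  rw [Finset.sum_add_distrib, ← Finset.add_sum_erase _ (fun l' => _ / _ * _) (Finset.mem_univ l),
    div_self hq, one_mul] at heq
  simp only [Pi.neg_apply, Pi.add_apply, Finset.sum_apply, Pi.mul_apply, affineCoord, formRatio]
  linear_combination -heq

end TangentSpaceXW

/-! ### The subbundle spanned by the `u_i` -/

section VectorsAlongA

variable {m n : ℕ} {k : Fin (n + 1)} {p : (Set.univ : Set (AffProj m n))}

lemma dA_partialA (p : (Set.univ : Set (AffProj m n))) (i : Fin m) :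
    dA p (partialA p i) = Pi.single i 1 := by
  ext l
  refine (dFun_apply (isRegularAt_affineCoord p l) (partialA p i)).trans ?_
  change deriv (fun t : ℂ => (p.1.a + Pi.single i t : Fin m → ℂ) l) 0 = _
  rcases eq_or_ne l i with rfl | hl
  · simp
  · simp [hl]

lemma dChart_partialA (hk : p.1.x.rep k ≠ 0) (i : Fin m) : dChart k p (partialA p i) = 0 := by
  ext j
  refine (dFun_apply (isRegularAt_chartCoord hk j) (partialA p i)).trans ?_
  exact deriv_const (0 : ℂ) (chartCoord _ k j p)

/-- The tangent vector `∑ i, α_i ∂/∂a_i` of `ℂ^m × ℙ^n`. -/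
def vectorA (p : (Set.univ : Set (AffProj m n))) : (Fin m → ℂ) →ₗ[ℂ] tangentSpace Set.univ p :=
  Fintype.linearCombination ℂ (partialA p)

lemma dA_vectorA (p : (Set.univ : Set (AffProj m n))) (α : Fin m → ℂ) :
    dA p (vectorA p α) = α := by
  simp only [vectorA, Fintype.linearCombination_apply, map_sum, map_smul, dA_partialA]
  exact (pi_eq_sum_univ' α).symm

lemma dChart_vectorA (hk : p.1.x.rep k ≠ 0) (α : Fin m → ℂ) : dChart k p (vectorA p α) = 0 := by
  simp only [vectorA, Fintype.linearCombination_apply, map_sum, map_smul, dChart_partialA hk,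
    smul_zero, Finset.sum_const_zero]

lemma dIncl_eq_vectorA_iff {S : Set (AffProj m n)} {p : S} (hk : p.1.x.rep k ≠ 0)
    {D : tangentSpace S p} {α : Fin m → ℂ} :
    dIncl S.subset_univ p D = vectorA _ α ↔ dA p D = α ∧ dChart k p D = 0 := by
  have hkZ : (Set.inclusion S.subset_univ p).1.x.rep k ≠ 0 := hk
  rw [← dA_dIncl S.subset_univ, ← dChart_dIncl S.subset_univ hk]
  refine ⟨fun h => ?_, fun h => tangent_ext hkZ ?_ ?_⟩
  · rw [h, dA_vectorA, dChart_vectorA hkZ]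
    exact ⟨rfl, rfl⟩
  · rw [h.1, dA_vectorA]
  · rw [h.2, dChart_vectorA hkZ]

lemma dIncl_mem_map_vectorA_iff {S : Set (AffProj m n)} {p : S} (hk : p.1.x.rep k ≠ 0)
    {D : tangentSpace S p} {B : Submodule ℂ (Fin m → ℂ)} :
    dIncl S.subset_univ p D ∈ B.map (vectorA _) ↔ dA p D ∈ B ∧ dChart k p D = 0 := by
  simp only [Submodule.mem_map, eq_comm (b := dIncl S.subset_univ p D), dIncl_eq_vectorA_iff hk]
  exact ⟨fun ⟨_, hα, hDα, hD⟩ => ⟨hDα ▸ hα, hD⟩, fun ⟨hα, hD⟩ => ⟨_, hα, rfl, hD⟩⟩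

end VectorsAlongA

section SubbundleG

variable {n h : ℕ} {f₀ : Form n h} {L : Fin (h + 1) → Form n 1} {k : Fin (n + 1)}

/-- The values of the forms `L_j` at the representative of a point. They depend on the
representative, but their multiples of the generator `repDual` of `O(1)` do not. -/
def formValues (L : Fin (h + 1) → Form n 1) (x : ℙ ℂ (Fin (n + 1) → ℂ)) (j : Fin (h + 1)) : ℂ :=
  eval x.rep (L j).1

lemma uField_eq_tmul (p : (Set.univ : Set (AffProj (h + 1) n))) (i : Fin h) : uField L p i =
    (vectorA p (uCoeff (formValues L p.1.x) i) ⊗ₜ[ℂ] repDual p.1.x :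
      tangentSpace Set.univ p ⊗[ℂ] lineFun 1 p.1.x) := by
  have hvec : vectorA p (uCoeff (formValues L p.1.x) i) =
      formValues L p.1.x 0 • partialA p 0 - formValues L p.1.x i.succ • partialA p i.succ := by
    simp only [uCoeff, vectorA, map_sub, map_smul, Fintype.linearCombination_apply_single,
      one_smul]
  rw [uField, hvec, TensorProduct.sub_tmul, TensorProduct.smul_tmul, TensorProduct.smul_tmul,
    formAt_eq_smul_repDual (L 0), formAt_eq_smul_repDual (L i.succ)]
  rfl

lemma span_uField (p : (Set.univ : Set (AffProj (h + 1) n))) :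
    Submodule.span ℂ (Set.range (uField L p)) =
      ((Submodule.span ℂ (Set.range (uCoeff (formValues L p.1.x)))).map (vectorA p)).map
        (twistEquiv (tangentSpace Set.univ p) _ (repDual_repVec_ne p.1.x)).toLinearMap := by
  rw [Submodule.map_span, Submodule.map_span, ← Set.range_comp, ← Set.range_comp]
  refine congrArg (fun u => Submodule.span ℂ (Set.range u)) (funext fun i => ?_)
  exact (uField_eq_tmul p i).trans (twistEquiv_apply _ _).symm

lemma linearIndependent_uField {p : (Set.univ : Set (AffProj (h + 1) n))}
    (hp : p.1.x ∈ openW L) : LinearIndependent ℂ (uField L p) := by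
  let e := twistEquiv (tangentSpace Set.univ p) _ (repDual_repVec_ne p.1.x)
  have hv : Function.Injective (vectorA p) := Function.LeftInverse.injective (dA_vectorA p)
  have hu : LinearIndependent ℂ fun i => e (vectorA p (uCoeff (formValues L p.1.x) i)) :=
    ((linearIndependent_uCoeff (eval_ne_or_eval_ne hp)).map_injOn _ hv.injOn).map_injOn
      e.toLinearMap e.injective.injOn
  have heq : uField L p = fun i => e (vectorA p (uCoeff (formValues L p.1.x) i)) :=
    funext fun i => (uField_eq_tmul p i).trans (twistEquiv_apply _ _).symm
  rw [heq]
  exact hu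

lemma sum_eval_omitProd_mul_eq_zero_iff {x : ℙ ℂ (Fin (n + 1) → ℂ)} (hx : x ∈ openW L)
    {α : Fin (h + 1) → ℂ} : ∑ l, eval x.rep (omitProd L l).1 * α l = 0 ↔
      α ∈ Submodule.span ℂ (Set.range (uCoeff (formValues L x))) := by
  simp only [eval_omitProd]
  exact (mem_span_uCoeff_iff (eval_ne_or_eval_ne hx)).symm

lemma tmul_repDual_mem_G1_iff {p : XW f₀ L} (hk : p.1.x.rep k ≠ 0) (D : tangentSpace (XW f₀ L) p) :
    (D ⊗ₜ[ℂ] repDual p.1.x : tangentSpace (XW f₀ L) p ⊗[ℂ] lineFun 1 p.1.x) ∈ G1 f₀ L p ↔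
      dChart k p D = 0 := by
  let q := Set.inclusion (XW f₀ L).subset_univ p
  let e := twistEquiv (tangentSpace Set.univ q) _ (repDual_repVec_ne q.1.x)
  change (dIncl (XW f₀ L).subset_univ p D ⊗ₜ[ℂ] repDual q.1.x :
    tangentSpace Set.univ q ⊗[ℂ] lineFun 1 q.1.x) ∈ Submodule.span ℂ (Set.range (uField L q)) ↔ _
  rw [span_uField q, ← twistEquiv_apply (repDual_repVec_ne q.1.x)]
  refine (Submodule.mem_map_equiv (e := e) _).trans ?_
  rw [LinearEquiv.symm_apply_apply, dIncl_mem_map_vectorA_iff hk,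
    ← sum_eval_omitProd_mul_eq_zero_iff p.2.1.2, and_iff_right_iff_imp]
  exact sum_eval_omitProd_mul_dA_eq_zero hk

lemma exists_dIncl_eq_vectorA_uCoeff (p : XW f₀ L) (i : Fin h) :
    ∃ D : tangentSpace (XW f₀ L) p, dIncl (XW f₀ L).subset_univ p D =
      vectorA _ (uCoeff (formValues L p.1.x) i) := by
  obtain ⟨k, hk⟩ := exists_rep_ne p.1.x
  obtain ⟨D, hD⟩ := exists_vertical_tangent_XW hk <|
    (sum_eval_omitProd_mul_eq_zero_iff p.2.1.2).2 (Submodule.subset_span (Set.mem_range_self i))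
  exact ⟨D, (dIncl_eq_vectorA_iff hk).2 hD⟩

variable (f₀ L) in
/-- The tangent vector of `X_W` whose product with `repDual` is `u_i`. -/
def uVector (i : Fin h) (p : XW f₀ L) : tangentSpace (XW f₀ L) p :=
  (exists_dIncl_eq_vectorA_uCoeff p i).choose

lemma dIncl_uVector (i : Fin h) (p : XW f₀ L) : dIncl (XW f₀ L).subset_univ p (uVector f₀ L i p) =
    vectorA _ (uCoeff (formValues L p.1.x) i) :=
  (exists_dIncl_eq_vectorA_uCoeff p i).choose_spec

variable (f₀ L) in
/-- The section `u_i` of `T X_W(1)`. -/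
def uSection (i : Fin h) (p : XW f₀ L) : (TXW1 f₀ L).fibre p :=
  (uVector f₀ L i p ⊗ₜ[ℂ] repDual p.1.x : tangentSpace (XW f₀ L) p ⊗[ℂ] lineFun 1 p.1.x)

lemma inclTotal_uSection (i : Fin h) (p : XW f₀ L) : inclTotal f₀ L p (uSection f₀ L i p) =
    uField L (Set.inclusion (XW f₀ L).subset_univ p) i := by
  rw [uField_eq_tmul]
  exact congrArg (· ⊗ₜ[ℂ] repDual p.1.x) (dIncl_uVector i p)

lemma isRegAt_uSection (i : Fin h) (p : XW f₀ L) : (TXW1 f₀ L).IsRegAt p (uSection f₀ L i) := by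
  obtain ⟨k, hk⟩ := exists_rep_ne p.1.x
  have hcoord {q : XW f₀ L} (hq : q.1.x.rep k ≠ 0) :=
    (dIncl_eq_vectorA_iff hq).1 (dIncl_uVector i q)
  have hL (j : Fin (h + 1)) : IsRegularAt (XW f₀ L) p (formRatio _ (L j) (varForm k)) :=
    isRegularAt_formRatio _ (by simpa using hk)
  refine (twist_isRegAt_iff (tangentBundle_hasRegularModule _) hk _).2
    ⟨fun q => (q.1.x.rep k)⁻¹ • uVector f₀ L i q,
      isRegAt_of_dA_of_dChart hk (fun l => ?_) fun j => ?_, ?_⟩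
  · refine (((hL 0).mul (isRegularAt_const p ((Pi.single 0 1 : Fin (h + 1) → ℂ) l))).add
      ((hL i.succ).mul
        (isRegularAt_const p ((Pi.single i.succ 1 : Fin (h + 1) → ℂ) l))).neg).congr ?_
    filter_upwards [eventually_rep_ne hk] with q hq
    rw [map_smul, (hcoord hq).1]
    simp only [Pi.add_apply, Pi.mul_apply, Pi.neg_apply, formRatio, eval_varForm, uCoeff,
      formValues, Pi.smul_apply, Pi.sub_apply, smul_eq_mul]
    ring
  · refine (isRegularAt_const p 0).congr ?_
    filter_upwards [eventually_rep_ne hk] with q hq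
    rw [map_smul, (hcoord hq).2, smul_zero, Pi.zero_apply]
  · filter_upwards [eventually_rep_ne hk] with q hq
    refine Eq.symm ((TensorProduct.smul_tmul _ _ _).trans ?_)
    rw [formAt_eq_smul_repDual, eval_varForm, inv_smul_smul₀ hq]
    rfl

lemma inclTotal_injective (p : XW f₀ L) : Function.Injective (inclTotal f₀ L p) := by
  have hinj : Function.Injective
      (LinearMap.rTensor (lineFun 1 p.1.x) (dIncl (XW f₀ L).subset_univ p)) :=
    Module.Flat.rTensor_preserves_injective_linearMap _ (dIncl_injective _ p)
  exact hinj

theorem finrank_G1 (p : XW f₀ L) : Module.finrank ℂ (G1 f₀ L p) = h := by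
  have hmap : (G1 f₀ L p).map (inclTotal f₀ L p) = Submodule.span ℂ (Set.range
      (uField L (Set.inclusion (XW f₀ L).subset_univ p))) := by
    refine Submodule.map_comap_eq_of_le (Submodule.span_le.2 ?_)
    rintro _ ⟨i, rfl⟩
    exact ⟨_, inclTotal_uSection i p⟩
  have hli := linearIndependent_uField (p := Set.inclusion (XW f₀ L).subset_univ p) p.2.1.2
  refine (Submodule.equivMapOfInjective _ (inclTotal_injective p) _).finrank_eq.trans ?_
  rw [hmap, finrank_span_eq_card hli, Fintype.card_fin]

end SubbundleG

/-! ### The isomorphism and its compatibilities -/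

section Quotient

variable {n h : ℕ} {f₀ : Form n h} {L : Fin (h + 1) → Form n 1} {p : XW f₀ L} {k : Fin (n + 1)}

variable (f₀ L) in
/-- The map `T X_W → T_{W/A}`, `α + v ↦ -v`. -/
def negProj (p : XW f₀ L) : tangentSpace (XW f₀ L) p →ₗ[ℂ]
    relTangentSpace AffProj.a (prodAW f₀ L) (Set.inclusion (XW_subset f₀ L) p) :=
  (-1 : ℂ) • (Submodule.projectionOnto _ _ (isCompl_relTangentSpace (isOpen_cone_prodAW f₀ L)
    (Set.inclusion (XW_subset f₀ L) p)) ∘ₗ dIncl (XW_subset f₀ L) p)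

lemma dIncl_add_negProj_mem (D : tangentSpace (XW f₀ L) p) :
    dIncl (XW_subset f₀ L) p D + (negProj f₀ L p D).1 ∈
      relTangentSpace AffProj.x (prodAW f₀ L) (Set.inclusion (XW_subset f₀ L) p) := by
  have hc := isCompl_relTangentSpace (isOpen_cone_prodAW f₀ L) (Set.inclusion (XW_subset f₀ L) p)
  rw [← Submodule.projectionOnto_apply_eq_zero_iff hc, map_add,
    Submodule.projectionOnto_apply_left hc]
  set v := Submodule.projectionOnto _ _ hc (dIncl (XW_subset f₀ L) p D)
  exact (congrArg (v + ·) (neg_one_smul ℂ v)).trans (add_neg_cancel v)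

lemma dFun_formRatio_negProj (D : tangentSpace (XW f₀ L) p) {d : ℕ} (f : Form n d) {Q : Form n d}
    (hQ : eval p.1.x.rep Q.1 ≠ 0) :
    dFun (formRatio _ f Q) _ (negProj f₀ L p D).1 = -dFun (formRatio _ f Q) p D := by
  have hsum := dFun_formRatio_eq_zero (dIncl_add_negProj_mem D) f hQ
  rw [map_add, dFun_dIncl (XW_subset f₀ L) (isRegularAt_formRatio f hQ)] at hsum
  exact eq_neg_of_add_eq_zero_right hsum

lemma dChart_negProj (hk : p.1.x.rep k ≠ 0) (D : tangentSpace (XW f₀ L) p) :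
    dChart k _ (negProj f₀ L p D).1 = -dChart k p D :=
  funext fun _ => dFun_formRatio_negProj D _ (by simpa using hk)

lemma negProj_eq_zero_iff (hk : p.1.x.rep k ≠ 0) {D : tangentSpace (XW f₀ L) p} :
    negProj f₀ L p D = 0 ↔ dChart k p D = 0 := by
  rw [← neg_eq_zero (a := dChart k p D), ← dChart_negProj hk]
  exact (LinearEquiv.map_eq_zero_iff (chartEquiv (isOpen_cone_prodAW f₀ L)
    (p := Set.inclusion (XW_subset f₀ L) p) hk)).symm

lemma negProj_surjective (p : XW f₀ L) : Function.Surjective (negProj f₀ L p) := by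
  intro E
  obtain ⟨k, hk⟩ := exists_rep_ne p.1.x
  obtain ⟨i, hi⟩ := exists_eval_omitProd_ne p.2.1.2
  obtain ⟨D, -, hD⟩ := exists_tangent_XW hk hi 0 (-dChart k _ E.1)
  refine ⟨D, (chartEquiv (isOpen_cone_prodAW f₀ L)
    (p := Set.inclusion (XW_subset f₀ L) p) hk).injective ?_⟩
  rw [chartEquiv_apply, chartEquiv_apply, dChart_negProj hk, hD, neg_neg]

variable (f₀ L) in
/-- The twist `T X_W(1) → T_{W/A}(1)` of `negProj`. -/
def negProjTwist (p : XW f₀ L) : (TXW1 f₀ L).fibre p →ₗ[ℂ] (TWA1 f₀ L).fibre p :=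
  LinearMap.rTensor (lineFun 1 p.1.x) (negProj f₀ L p)

lemma negProjTwist_surjective (p : XW f₀ L) : Function.Surjective (negProjTwist f₀ L p) :=
  LinearMap.rTensor_surjective _ (negProj_surjective p)

lemma negProjTwist_tmul_eq_zero_iff (D : tangentSpace (XW f₀ L) p) :
    negProjTwist f₀ L p
        (D ⊗ₜ[ℂ] repDual p.1.x : tangentSpace (XW f₀ L) p ⊗[ℂ] lineFun 1 p.1.x) = 0 ↔
      negProj f₀ L p D = 0 := by
  have heq := twistEquiv_apply (repDual_repVec_ne p.1.x) (negProj f₀ L p D)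
  exact (Eq.congr_left heq).symm.trans (LinearEquiv.map_eq_zero_iff _)

lemma G1_eq_ker (p : XW f₀ L) : G1 f₀ L p = LinearMap.ker (negProjTwist f₀ L p) := by
  ext τ
  obtain ⟨k, hk⟩ := exists_rep_ne p.1.x
  obtain ⟨D, rfl⟩ := exists_eq_tmul (V := tangentSpace (XW f₀ L) p) (repDual_repVec_ne p.1.x) τ
  exact (tmul_repDual_mem_G1_iff hk D).trans <|
    (negProj_eq_zero_iff hk).symm.trans (negProjTwist_tmul_eq_zero_iff D).symm

variable (f₀ L) in
/-- The isomorphism `T X_W(1) / G(1) ≅ T_{W/A}(1)` on the fibres at a point. -/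
def quotEquiv (p : XW f₀ L) : ((TXW1 f₀ L).fibre p ⧸ G1 f₀ L p) ≃ₗ[ℂ] (TWA1 f₀ L).fibre p :=
  (Submodule.quotEquivOfEq _ _ (G1_eq_ker p)).trans
    ((negProjTwist f₀ L p).quotKerEquivOfSurjective (negProjTwist_surjective p))

lemma quotEquiv_mk_tmul (hk : p.1.x.rep k ≠ 0) (D : tangentSpace (XW f₀ L) p) :
    quotEquiv f₀ L p (Submodule.Quotient.mk
        (D ⊗ₜ[ℂ] formAt (varForm k) p.1.x : tangentSpace (XW f₀ L) p ⊗[ℂ] lineFun 1 p.1.x)) =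
      ∑ j, (-dChart k p D) j •
        chartFrame (isOpen_cone_prodAW f₀ L) (XW_subset f₀ L) k j p := by
  rw [← dChart_negProj hk]
  exact (sum_dChart_smul_chartFrame (isOpen_cone_prodAW f₀ L) (XW_subset f₀ L) hk _).symm

lemma exists_isRegAt_dChart_eq (hk : p.1.x.rep k ≠ 0) {g : Fin n → XW f₀ L → ℂ}
    (hg : ∀ j, IsRegularAt (XW f₀ L) p (g j)) :
    ∃ D : ∀ q, tangentSpace (XW f₀ L) q, (tangentBundle (XW f₀ L)).IsRegAt p D ∧
      ∀ᶠ q in 𝓝 p, dChart k q (D q) = fun j => g j q := by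
  obtain ⟨i, hi⟩ := exists_eval_omitProd_ne p.2.1.2
  choose! D hDa hDx using fun (q : XW f₀ L)
    (hq : q.1.x.rep k ≠ 0 ∧ eval q.1.x.rep (omitProd L i).1 ≠ 0) =>
      exists_tangent_XW hq.1 hq.2 0 fun j => g j q
  have hne := (eventually_rep_ne hk).and (eventually_eval_rep_ne hi)
  refine ⟨D, isRegAt_of_dA_of_ne hk hi (fun l hl => ?_) fun j => ?_, hne.mono hDx⟩
  · exact (isRegularAt_const p 0).congr (hne.mono fun q hq => (hDa q hq l hl).symm)
  · exact (hg j).congr (hne.mono fun q hq => (congrFun (hDx q hq) j).symm)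

lemma quot_isRegAt_iff (p : XW f₀ L) (s : ∀ q, (TXW1 f₀ L).fibre q ⧸ G1 f₀ L q) :
    ((TXW1 f₀ L).quot (G1 f₀ L)).IsRegAt p s ↔
      (TWA1 f₀ L).IsRegAt p (fun q => quotEquiv f₀ L q (s q)) := by
  obtain ⟨k, hk⟩ := exists_rep_ne p.1.x
  have hmod := tangentBundle_hasRegularModule (XW f₀ L)
  refine Iff.trans ?_
    (restrict_twist_isRegAt_iff (isOpen_cone_prodAW f₀ L) (XW_subset f₀ L) hk _).symm
  constructor
  · rintro ⟨t, ht, hst⟩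
    obtain ⟨D, hD, htD⟩ := (twist_isRegAt_iff hmod hk t).1 ht
    refine ⟨fun j q => (-dChart k q (D q)) j,
      fun j => (isRegularAt_dFun hD (isRegularAt_chartCoord hk j)).neg, ?_⟩
    filter_upwards [hst, htD, eventually_rep_ne hk] with q hsq htq hkq
    rw [hsq, htq]
    exact quotEquiv_mk_tmul hkq (D q)
  · rintro ⟨g, hg, hs⟩
    obtain ⟨D, hD, hDg⟩ := exists_isRegAt_dChart_eq hk fun j => (hg j).neg
    refine ⟨fun q => (D q ⊗ₜ[ℂ] formAt (varForm k) q.1.x :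
      tangentSpace (XW f₀ L) q ⊗[ℂ] lineFun 1 q.1.x), (twist_isRegAt_iff hmod hk _).2
        ⟨D, hD, Eventually.of_forall fun _ => rfl⟩, ?_⟩
    filter_upwards [hs, hDg, eventually_rep_ne hk] with q hsq hDq hkq
    refine (quotEquiv f₀ L q).injective (hsq.trans (Eq.trans ?_ (quotEquiv_mk_tmul hkq _).symm))
    simp only [hDq, Pi.neg_apply, neg_neg]

variable (f₀ L) in
/-- The isomorphism `T X_W(1) / G(1) ≅ T_{W/A}(1)`. -/
def quotIso : RegBundle.Iso ((TXW1 f₀ L).quot (G1 f₀ L)) (TWA1 f₀ L) where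
  equiv := quotEquiv f₀ L
  isRegAt_iff := quot_isRegAt_iff

lemma inclAW_add_inclW_mem (p : XW f₀ L) (τ : (TXW1 f₀ L).fibre p) :
    inclAW f₀ L p τ + inclW f₀ L p (negProjTwist f₀ L p τ) ∈ LinearMap.range (inclA f₀ L p) := by
  obtain ⟨D, rfl⟩ := exists_eq_tmul (V := tangentSpace (XW f₀ L) p) (repDual_repVec_ne p.1.x) τ
  refine ⟨((⟨_, dIncl_add_negProj_mem D⟩ : relTangentSpace AffProj.x (prodAW f₀ L)
    (Set.inclusion (XW_subset f₀ L) p)) ⊗ₜ[ℂ] repDual p.1.x :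
      relTangentSpace AffProj.x (prodAW f₀ L) (Set.inclusion (XW_subset f₀ L) p) ⊗[ℂ]
        lineFun 1 p.1.x), ?_⟩
  exact TensorProduct.add_tmul _ _ _

lemma nuOne_negProj (hp : p.1.a = 0) (Q : Form n h) (hQ : eval p.1.x.rep Q.1 ≠ 0)
    (D : tangentSpace (XW f₀ L) p) :
    nuOne f₀ L p Q hQ (negProj f₀ L p D) = muOne f₀ L p D := by
  have hnu : nuOne f₀ L p Q hQ (negProj f₀ L p D) =
      dFun (formRatio _ f₀ Q) _ (negProj f₀ L p D).1 • formAt Q p.1.x := by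
    rw [dFun_apply (isRegularAt_formRatio (p := Set.inclusion (XW_subset f₀ L) p) f₀ hQ)]
    rfl
  have hmu : muOne f₀ L p D = ∑ i, dA p D i • formAt (omitProd L i) p.1.x := by
    simp only [fun i => show dA p D i = D.1 (coordA (XW f₀ L) p i) from
      dFun_apply (isRegularAt_affineCoord p i) D]
    rfl
  have hM (i : Fin (h + 1)) : formAt (omitProd L i) p.1.x =
      (eval p.1.x.rep (omitProd L i).1 / eval p.1.x.rep Q.1) • formAt Q p.1.x :=
    (div_smul_lineFun (ζ := formAt Q p.1.x) hQ _).symm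
  have heq := dFun_equation D hQ
  simp only [hp, Pi.zero_apply, zero_mul, zero_add] at heq
  rw [hnu, hmu, dFun_formRatio_negProj D f₀ hQ, neg_eq_of_add_eq_zero_right heq, Finset.sum_smul]
  simp only [hM, smul_smul, mul_comm (dA p D _)]

lemma nu_negProjTwist (hp : p.1.a = 0) (Q : Form n h) (hQ : eval p.1.x.rep Q.1 ≠ 0)
    (τ : (TXW1 f₀ L).fibre p) : nu f₀ L p Q hQ (negProjTwist f₀ L p τ) = mu f₀ L p τ := by
  obtain ⟨D, rfl⟩ := exists_eq_tmul (V := tangentSpace (XW f₀ L) p) (repDual_repVec_ne p.1.x) τ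
  exact congrArg (fun s => lineMul h 1 s (repDual p.1.x)) (nuOne_negProj hp Q hQ D)

end Quotient

end ClemensFamily

end

theorem theorem2p1_general (n h : ℕ) (f₀ : Form n h) (L : Fin (h + 1) → Form n 1) :
    (∀ i : Fin h, ∃ s : ∀ p, (TXW1 f₀ L).fibre p, (∀ p, (TXW1 f₀ L).IsRegAt p s) ∧
      ∀ p, inclTotal f₀ L p (s p) =
        uField L (Set.inclusion (Set.subset_univ (XW f₀ L)) p) i) ∧
    (∀ p, Module.finrank ℂ (G1 f₀ L p) = h) ∧
    (TWA1 f₀ L).IsLocallyFree n ∧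
    ∃ I : RegBundle.Iso ((TXW1 f₀ L).quot (G1 f₀ L)) (TWA1 f₀ L),
      (∀ (p : XW f₀ L) (τ : (TXW1 f₀ L).fibre p),
        inclAW f₀ L p τ + inclW f₀ L p (I.equiv p (Submodule.Quotient.mk τ)) ∈
          LinearMap.range (inclA f₀ L p)) ∧
      (∀ (p : XW f₀ L), p.1.a = 0 →
        ∀ (Q : Form n h) (hQ : MvPolynomial.eval p.1.x.rep Q.1 ≠ 0) (τ : (TXW1 f₀ L).fibre p),
          nu f₀ L p Q hQ (I.equiv p (Submodule.Quotient.mk τ)) = mu f₀ L p τ) :=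
  ⟨fun i => ⟨uSection f₀ L i, isRegAt_uSection i, inclTotal_uSection i⟩, finrank_G1,
    isLocallyFree_restrict_twist (isOpen_cone_prodAW f₀ L) (XW_subset f₀ L), quotIso f₀ L,
    inclAW_add_inclW_mem, fun _ hp Q hQ τ => nu_negProjTwist hp Q hQ τ⟩

theorem theorem2p1 (n h : ℕ) (f₀ : Form n h) (L : Fin (h + 1) → Form n 1)
    (hf₀ : IsSmoothForm f₀.1) (hL : ∀ i, L i ≠ 0)
    (hdiv : ∀ i j, i ≠ j → projZeros (L i) ≠ projZeros (L j)) :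
    -- the `u_i` are tangent to `X_W`, regular there, and span a subbundle of rank `h`
    (∀ i : Fin h, ∃ s : ∀ p, (TXW1 f₀ L).fibre p, (∀ p, (TXW1 f₀ L).IsRegAt p s) ∧
      ∀ p, inclTotal f₀ L p (s p) =
        uField L (Set.inclusion (Set.subset_univ (XW f₀ L)) p) i) ∧
    (∀ p, Module.finrank ℂ (G1 f₀ L p) = h) ∧
    -- `T_{W/A}(1)` is a vector bundle of rank `n` on `X_W`, isomorphic to `T X_W(1) / G(1)`
    (TWA1 f₀ L).IsLocallyFree n ∧
    ∃ I : RegBundle.Iso ((TXW1 f₀ L).quot (G1 f₀ L)) (TWA1 f₀ L),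
      -- `I` maps the class of `τ = α + v`, with `α` along `A` and `v` along `W`, to `-v`
      (∀ (p : XW f₀ L) (τ : (TXW1 f₀ L).fibre p),
        inclAW f₀ L p τ + inclW f₀ L p (I.equiv p (Submodule.Quotient.mk τ)) ∈
          LinearMap.range (inclA f₀ L p)) ∧
      -- over `{f₀} × f₀^W` the differential maps to `O(h + 1)` correspond under `I`
      (∀ (p : XW f₀ L), p.1.a = 0 →
        ∀ (Q : Form n h) (hQ : MvPolynomial.eval p.1.x.rep Q.1 ≠ 0) (τ : (TXW1 f₀ L).fibre p),
          nu f₀ L p Q hQ (I.equiv p (Submodule.Quotient.mk τ)) = mu f₀ L p τ) :=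
  theorem2p1_general n h f₀ L
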